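/- There are absolute constants $c, C > 0$ such that the following holds for all real $\delta > 0$. Let $q$ be a prime power, let $n \ge 0$, and let $G$ be a classical group $\mathrm{Cl}_n(q)$, that is, a group with $\mathrm{SCl}_n(q) \le G \le \mathrm{GCl}_n(q) \le \mathrm{GL}_n(q)$, where the pair $(\mathrm{SCl}_n(q), \mathrm{GCl}_n(q))$ is one of the following: $(\mathrm{SL}_n(q), \mathrm{GL}_n(q))$; $(\mathrm{Sp}_n(q), \mathrm{Sp}_n(q))$, the isometry group of a nondegenerate alternating form on $\mathbf{F}_q^n$ ($n$ even); $(\Omega_n^{(\pm)}(q), \mathrm{GO}_n^{(\pm)}(q))$, where $\mathrm{GO}_n^{(\pm)}(q)$ is the isometry group of a quadratic form $Q$ on $\mathbf{F}_q^n$ whose polar form $Q(u+v)-Q(u)-Q(v)$ is nondegenerate, $\mathrm{SO}_n^{(\pm)}(q)$ is its subgroup of elements of determinant $1$, and $\Omega_n^{(\pm)}(q) = \mathrm{SO}_n^{(\pm)}(q)'$ is the commutator subgroup of the latter; or $(\mathrm{SU}_n(q), \mathrm{GU}_n(q))$, where $q$ is a square, $\mathrm{GU}_n(q)$ is the isometry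 group of a nondegenerate form on $\mathbf{F}_q^n$ that is hermitian with respect to the automorphism of $\mathbf{F}_q$ of order $2$, and $\mathrm{SU}_n(q)$ is its subgroup of elements of determinant $1$. For $g \in \mathrm{GL}_n(q)$ let $$\operatorname{supp} g = \min_{\lambda \in \overline{\mathbf{F}_q}} \operatorname{rank}(g - \lambda).$$ Let $w$ be a nontrivial element of the free group $F_k$ on $k$ generators, of reduced length $\ell < \delta^2 n / 20$, and assume that $q^{\delta n} > C$. Let $x_1, \dots, x_k$ be chosen independently and uniformly at random from $G$. Then $$\mathbf{P}\bigl(\operatorname{supp} w(x_1, \dots, x_k) \le (1-\delta) n\bigr) \le |G|^{-c\delta^2/\ell}.$$ -/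

import Mathlib

open Matrix

namespace ClassicalGroup

/-- The data defining a family of classical groups on the natural module `F ^ n`, `F` a finite
field: no form (linear case), a nondegenerate alternating bilinear form (symplectic case), a
quadratic form whose polar form `Q (u + v) - Q u - Q v` is nondegenerate (orthogonal case; in
characteristic two this forces `n` to be even), or a nondegenerate hermitian form with respect to
an automorphism `θ` of `F` of order two (unitary case). -/
inductive FormData (F : Type*) [Field F] (n : ℕ) where
  | linear : FormData F n
  | symplectic (f : LinearMap.BilinForm F (Fin n → F)) (alternating : f.IsAlt)
      (nondegenerate : LinearMap.Nondegenerate f) : FormData F n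
  | orthogonal (Q : QuadraticForm F (Fin n → F))
      (nondegenerate : LinearMap.Nondegenerate (QuadraticMap.polarBilin Q)) : FormData F n
  | unitary (θ : F →+* F) (ne_id : θ ≠ RingHom.id F) (involutive : ∀ x, θ (θ x) = x)
      (f : (Fin n → F) →ₗ[F] (Fin n → F) →ₛₗ[θ] F) (hermitian : ∀ u v, f v u = θ (f u v))
      (nondegenerate : LinearMap.Nondegenerate f) : FormData F n

variable {F : Type*} [Field F] {n : ℕ}

/-- The subgroup of `GL_n(F)` of all `g` with `B (g u) (g v) = B u v` for all `u`, `v`. -/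
def isometryGroup (B : (Fin n → F) → (Fin n → F) → F) : Subgroup (GL (Fin n) F) where
  carrier := {g | ∀ u v, B (g.1 *ᵥ u) (g.1 *ᵥ v) = B u v}
  one_mem' := by intro u v; simp
  mul_mem' := by
    intro g h hg hh u v
    simp only [Set.mem_ofPred_eq] at hg hh
    rw [Units.val_mul, ← mulVec_mulVec, ← mulVec_mulVec, hg, hh]
  inv_mem' := by
    intro g hg u v
    have h := hg (g⁻¹.1 *ᵥ u) (g⁻¹.1 *ᵥ v)
    rw [mulVec_mulVec, mulVec_mulVec, Units.mul_inv, one_mulVec, one_mulVec] at h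
    exact h.symm

/-- The subgroup of `GL_n(F)` of all `g` with `Q (g v) = Q v` for all `v`. -/
def orthogonalGroup (Q : QuadraticForm F (Fin n → F)) : Subgroup (GL (Fin n) F) where
  carrier := {g | ∀ v, Q (g.1 *ᵥ v) = Q v}
  one_mem' := by intro v; simp
  mul_mem' := by
    intro g h hg hh v
    simp only [Set.mem_ofPred_eq] at hg hh
    rw [Units.val_mul, ← mulVec_mulVec, hg, hh]
  inv_mem' := by
    intro g hg v
    have h := hg (g⁻¹.1 *ᵥ v)
    rw [mulVec_mulVec, Units.mul_inv, one_mulVec] at h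
    exact h.symm

/-- `SL_n(F)` as a subgroup of `GL_n(F)`. -/
def specialSubgroup (F : Type*) [Field F] (n : ℕ) : Subgroup (GL (Fin n) F) :=
  (Matrix.GeneralLinearGroup.det : GL (Fin n) F →* Fˣ).ker

/-- `GCl_n(q)`: the full isometry group `GL_n`, `Sp_n`, `GO_n` or `GU_n`. -/
def FormData.gcl : FormData F n → Subgroup (GL (Fin n) F)
  | .linear => ⊤
  | .symplectic f _ _ => isometryGroup fun u v => f u v
  | .orthogonal Q _ => orthogonalGroup Q
  | .unitary _ _ _ f _ _ => isometryGroup fun u v => f u v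

/-- `SCl_n(q)`: the group `SL_n`, `Sp_n`, `Ω_n` or `SU_n`, where `Ω_n` is the commutator subgroup
of `SO_n`. -/
def FormData.scl : FormData F n → Subgroup (GL (Fin n) F)
  | .linear => specialSubgroup F n
  | .symplectic f _ _ => isometryGroup fun u v => f u v
  | .orthogonal Q _ =>
      ⁅orthogonalGroup Q ⊓ specialSubgroup F n, orthogonalGroup Q ⊓ specialSubgroup F n⁆
  | .unitary _ _ _ f _ _ => (isometryGroup fun u v => f u v) ⊓ specialSubgroup F n

/-- `G` is a group `Cl_n(q)`: it lies between `SCl_n(q)` and `GCl_n(q)`, for one of the four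
types of form. -/
def IsClassical (G : Subgroup (GL (Fin n) F)) : Prop :=
  ∃ φ : FormData F n, φ.scl ≤ G ∧ G ≤ φ.gcl

/-- The support of `g`: the minimum of `rank (g - a)` over all scalars `a` in the algebraic
closure of `F`. -/
noncomputable def supp (g : GL (Fin n) F) : ℕ :=
  ⨅ a : AlgebraicClosure F,
    (g.1.map (algebraMap F (AlgebraicClosure F)) - Matrix.scalar (Fin n) a).rank

/-- The value `w(x_1, …, x_k)` of a word of the free group of rank `k`. -/
def evalWord {G : Type*} [Group G] {k : ℕ} (w : FreeGroup (Fin k)) (x : Fin k → G) : G :=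
  FreeGroup.lift x w

/-- The probability of the event `E` for a uniformly random element of the finite type `α`. For
`α = (Fin k → G)` the `k` coordinates are independent and uniform in `G`. -/
noncomputable def uniformProb {α : Type*} (E : α → Prop) : ℝ :=
  (Nat.card {x : α // E x} : ℝ) / (Nat.card α : ℝ)

end ClassicalGroup

/-!
The probability that a word value has small support is bounded by counting vectors with small
cyclic subspace, through a high moment.

*From support to cyclic vectors.* Let `κ = n - supp g`, attained at an eigenvalue `a` of degree `d`
over `F = 𝔽_q`. The eigenspace of `g` for `a` has dimension `κ` over `F(a)`, and a nonzero
functional `F(a) → F`, applied to each coordinate, embeds it into the kernel of `p(g)` on `F ^ n`,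
where `p` is the minimal polynomial of `a`. So at least `q ^ (d κ)` vectors `v` satisfy
`g ^ d v ∈ ⟨v, g v, …, g ^ (d - 1) v⟩` (`pow_le_card_cyclicVectors`). As `d κ ≤ n`, only the degrees
`d ≤ 1 / δ` occur.

*Moments.* Let `w` be cyclically reduced, as may be assumed since the support is a class function.
Then `w ^ d` is reduced, and the relation for `v` forces a coincidence in the walk of `v` along
`w ^ d`: some step ends in the span of the vectors met before. The walk is revealed step by step.
Before the first coincidence each letter is applied to a vector outside the subspace on which its
action is already prescribed, so its value is spread over an orbit of a pointwise stabilizer, which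
is nearly as large as `F ^ n`. Coincidences are therefore rare (`sum_coincidence_mul_le`). Revealing
`r` vectors in succession bounds the `r`-th moment of the number of such vectors
(`sum_pow_card_mul_le`), and Markov's inequality with some `r` above `δ n / (40 ℓ)` gives
the theorem (`exists_card_mul_pow_le`).

*Orbits.* What the moments need of the classical group is only this lower bound on orbits
(`IsClassical.pow_le_card_stabOrbit`), and it comes from explicit elements of `SCl_n(q)`, with no
appeal to Witt's theorem: transvections for `SL` and `Sp`; for `SU`, quasi-reflections whose
determinant is corrected by a second one with a centre orthogonal to everything in sight; for `Ω`,
the squares `(r_a r_c) ^ 2` of products of two reflections, which are the commutators of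
`r_a r_z` and `r_c r_z` for any nonsingular `z` orthogonal to `a` and `c`.
-/

namespace ClassicalGroup

/-! ### Walks of a random tuple and their coincidences -/

section Trajectories

open Finset Module
open scoped Classical

variable {F V G : Type*} [Field F] [Fintype F] [AddCommGroup V] [Module F V] [Fintype V]
  [Group G] [Fintype G] {k : ℕ}

/-- The group element that the letter `t` of a word takes when `x` is substituted for the
generators: `x_j` for `(j, true)` and `x_j⁻¹` for `(j, false)`. -/
def letterVal (x : Fin k → G) (t : Fin k × Bool) : G := cond t.2 (x t.1) (x t.1)⁻¹

/-- `X` is a set of tuples `x` cut out by prescribing the action of each letter `t` on the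
subspace `D t`. The prescribed values themselves are not recorded: all that the counting needs is
that `X` contains every tuple agreeing on the `D t` with one of its members, and that the domains
prescribed for a letter and for its inverse correspond. -/
structure IsPrescribed (ρ : Representation F G V) (X : Finset (Fin k → G))
    (D : Fin k × Bool → Submodule F V) : Prop where
  closed : ∀ x ∈ X, ∀ x' : Fin k → G,
    (∀ t, ∀ v ∈ D t, ρ (letterVal x' t) v = ρ (letterVal x t) v) → x' ∈ X
  maps : ∀ x ∈ X, ∀ t, ∀ v ∈ D t, ρ (letterVal x t) v ∈ D (t.1, !t.2)

/-- Every vector outside a subspace `W` of dimension at most `M` has at least `L` images under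
the pointwise stabilizer of `W`. -/
def OrbitBound (ρ : Representation F G V) (M L : ℕ) : Prop :=
  ∀ W : Submodule F V, finrank F W ≤ M → ∀ v, v ∉ W →
    L ≤ #{y | ∃ h : G, (∀ w ∈ W, ρ h w = w) ∧ ρ h v = y}

/-- The walk that starts at `u` and applies the letters of the list in turn meets a coincidence:
at some step the new vector lies in the span of `U` and of the vectors visited before. -/
def Coincidence (ρ : Representation F G V) (x : Fin k → G) :
    Submodule F V → V → List (Fin k × Bool) → Prop
  | _, _, [] => False
  | U, u, s :: l => ρ (letterVal x s) u ∈ U ⊔ F ∙ u ∨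
      Coincidence ρ x (U ⊔ F ∙ u) (ρ (letterVal x s) u) l

variable {ρ : Representation F G V}

omit [Fintype G] in
lemma letterVal_inv (x : Fin k → G) (t : Fin k × Bool) :
    letterVal x (t.1, !t.2) = (letterVal x t)⁻¹ := by
  rcases t with ⟨j, _ | _⟩ <;> simp [letterVal]

omit [Fintype F] [Fintype V] [Fintype G] in
lemma rep_injective (g : G) : Function.Injective (ρ g) := by
  intro a b h
  have := congrArg (ρ g⁻¹) h
  simpa using this

omit [Fintype F] [Fintype V] in
lemma isPrescribed_univ : IsPrescribed ρ (univ : Finset (Fin k → G)) fun _ => ⊥ where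
  closed := by simp
  maps := by
    intro x _ t v hv
    rw [(Submodule.mem_bot F).1 hv, map_zero]
    exact zero_mem _

omit [Fintype F] [Fintype V] [Fintype G] in
/-- Prescribing that the letter `t` sends `u` to `y` enlarges the domain of `t` by `u` and that
of the inverse letter by `y`. -/
lemma IsPrescribed.extend {X : Finset (Fin k → G)} {D : Fin k × Bool → Submodule F V}
    (hX : IsPrescribed ρ X D) (t : Fin k × Bool) (u y : V) :
    IsPrescribed ρ {x ∈ X | ρ (letterVal x t) u = y}
      fun s => if s = t then D s ⊔ F ∙ u else if s = (t.1, !t.2) then D s ⊔ F ∙ y else D s where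
  closed := by
    intro x hx x' hx'
    rw [mem_filter] at hx ⊢
    refine ⟨hX.closed x hx.1 x' fun s v hv => hx' s v ?_, ?_⟩
    · split_ifs
      exacts [Submodule.mem_sup_left hv, Submodule.mem_sup_left hv, hv]
    · rw [hx' t u, hx.2]
      rw [if_pos rfl]
      exact Submodule.mem_sup_right (Submodule.mem_span_singleton_self u)
  maps := by
    intro x hx s v hv
    rw [mem_filter] at hx
    have hne : ((t.1, !t.2) : Fin k × Bool) ≠ t := by
      intro h; have := congrArg Prod.snd h; simp at this
    by_cases hs : s = t
    · subst hs
      rw [if_pos rfl] at hv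
      rw [if_neg hne, if_pos rfl]
      obtain ⟨a, ha, b, hb, rfl⟩ := Submodule.mem_sup.1 hv
      obtain ⟨c, rfl⟩ := Submodule.mem_span_singleton.1 hb
      rw [map_add, map_smul, hx.2]
      exact add_mem (Submodule.mem_sup_left (hX.maps x hx.1 _ _ ha))
        (Submodule.mem_sup_right (Submodule.smul_mem _ _ (Submodule.mem_span_singleton_self y)))
    · rw [if_neg hs] at hv
      by_cases hs' : s = (t.1, !t.2)
      · subst hs'
        rw [if_pos rfl] at hv
        have htt : ((t.1, !!t.2) : Fin k × Bool) = t := by simp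
        simp only [htt, if_true]
        obtain ⟨a, ha, b, hb, rfl⟩ := Submodule.mem_sup.1 hv
        obtain ⟨c, rfl⟩ := Submodule.mem_span_singleton.1 hb
        have hy : ρ (letterVal x (t.1, !t.2)) y = u := by
          rw [letterVal_inv, ← hx.2]; simp
        rw [map_add, map_smul, hy]
        refine add_mem (Submodule.mem_sup_left ?_)
          (Submodule.mem_sup_right (Submodule.smul_mem _ _ (Submodule.mem_span_singleton_self u)))
        have := hX.maps x hx.1 _ _ ha
        simpa only [htt] using this
      · rw [if_neg hs'] at hv
        have h := hX.maps x hx.1 _ _ hv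
        split_ifs
        exacts [Submodule.mem_sup_left h, Submodule.mem_sup_left h, h]

omit [Fintype F] in
/-- Outside its prescribed domain a letter is equidistributed over an orbit of a pointwise
stabilizer, so that it takes each value with probability at most `1 / L`. -/
lemma IsPrescribed.card_fiber_mul_le {X : Finset (Fin k → G)} {D : Fin k × Bool → Submodule F V}
    (hX : IsPrescribed ρ X D) {M L : ℕ} (hL : OrbitBound ρ M L) {t : Fin k × Bool} {u : V}
    (hD : finrank F (D t) ≤ M) (hu : u ∉ D t) (y : V) :
    #{x ∈ X | ρ (letterVal x t) u = y} * L ≤ #X := by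
  refine (Nat.mul_le_mul_left _ (hL (D t) hD u hu)).trans ?_
  have hch : ∀ z : V, ∃ h : G, z ∈ ({y | ∃ h : G, (∀ w ∈ D t, ρ h w = w) ∧ ρ h u = y} : Finset V) →
      (∀ w ∈ D t, ρ h w = w) ∧ ρ h u = z := by
    intro z
    by_cases hz : z ∈ ({y | ∃ h : G, (∀ w ∈ D t, ρ h w = w) ∧ ρ h u = y} : Finset V)
    · obtain ⟨h, hh⟩ := (mem_filter.1 hz).2
      exact ⟨h, fun _ => hh⟩
    · exact ⟨1, fun h => absurd h hz⟩
  choose h hh using hch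
  -- `x` is changed in one coordinate so that the letter `t` gets multiplied by `(h z)⁻¹`
  let φ : (Fin k → G) × V → (Fin k → G) := fun p =>
    Function.update p.1 t.1 (cond t.2 (p.1 t.1 * (h p.2)⁻¹) (h p.2 * p.1 t.1))
  have hφt : ∀ p, letterVal (φ p) t = letterVal p.1 t * (h p.2)⁻¹ := by
    rintro ⟨x, z⟩
    rcases t with ⟨j, _ | _⟩ <;> simp [φ, letterVal]
  have hφne : ∀ p j b, j ≠ t.1 → letterVal (φ p) (j, b) = letterVal p.1 (j, b) := by
    rintro ⟨x, z⟩ j b hj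
    simp [φ, letterVal, hj]
  rw [← card_product]
  refine card_le_card_of_injOn φ ?_ ?_
  · rintro ⟨x, z⟩ hp
    simp only [coe_product, Set.mem_prod, mem_coe] at hp
    have hx := mem_filter.1 hp.1
    obtain ⟨h1, h2⟩ := hh z hp.2
    have h1' : ∀ w ∈ D t, ρ (h z)⁻¹ w = w := by
      intro w hw
      conv_lhs => rw [← h1 w hw]
      simp
    refine hX.closed x hx.1 _ ?_
    rintro ⟨j, b⟩ v hv
    by_cases hj : j = t.1
    · by_cases hb : b = t.2
      · have : ((j, b) : Fin k × Bool) = t := by rw [hj, hb]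
        rw [this] at hv ⊢
        rw [hφt, map_mul, Module.End.mul_apply, h1' v hv]
      · have hb' : b = !t.2 := by
          cases b <;> cases hh : t.2 <;> simp_all
        have : ((j, b) : Fin k × Bool) = (t.1, !t.2) := by rw [hj, hb']
        rw [this] at hv ⊢
        rw [letterVal_inv, letterVal_inv, hφt, _root_.mul_inv_rev, inv_inv, map_mul,
          Module.End.mul_apply]
        apply h1
        have := hX.maps x hx.1 _ v hv
        rw [letterVal_inv] at this
        simpa using this
    · rw [hφne _ _ _ hj]
  · rintro ⟨x, z⟩ hp ⟨x', z'⟩ hp' heq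
    simp only [coe_product, Set.mem_prod, mem_coe] at hp hp'
    have key : ∀ x z, x ∈ ({x ∈ X | ρ (letterVal x t) u = y} : Finset _) →
        z ∈ ({y | ∃ h : G, (∀ w ∈ D t, ρ h w = w) ∧ ρ h u = y} : Finset V) →
        ρ (letterVal (φ (x, z)) t) z = y := by
      intro x z hx hz
      have h2 := (hh z hz).2
      have h3 : ρ (h z)⁻¹ z = u := by
        apply rep_injective (ρ := ρ) (h z)
        rw [h2]; simp
      rw [hφt, map_mul, Module.End.mul_apply, h3, (mem_filter.1 hx).2]
    have hz : z = z' := by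
      apply rep_injective (ρ := ρ) (letterVal (φ (x, z)) t)
      rw [key x z hp.1 hp.2, heq, key x' z' hp'.1 hp'.2]
    subst hz
    refine Prod.ext ?_ rfl
    funext j
    by_cases hj : j = t.1
    · have h3 := congrArg (fun a => letterVal a t) heq
      simp only [hφt] at h3
      have h4 := mul_right_cancel h3
      subst hj
      rcases ht : t with ⟨j, _ | _⟩ <;> simp_all [letterVal]
    · have h3 := hφne (x, z) j true hj
      have h4 := hφne (x', z) j true hj
      rw [heq] at h3
      simpa [letterVal] using h3.symm.trans h4

omit [Fintype F] in
lemma finrank_sup_span_singleton_le (U : Submodule F V) (u : V) :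
    finrank F (U ⊔ F ∙ u : Submodule F V) ≤ finrank F U + 1 :=
  (Submodule.finrank_add_le_finrank_add_finrank _ _).trans
    (Nat.add_le_add_left ((finrank_span_le_card {u}).trans (by simp)) _)

lemma card_mem_le_pow (U : Submodule F V) {m : ℕ} (h : finrank F U ≤ m) :
    #{y : V | y ∈ U} ≤ Fintype.card F ^ m := by
  rw [← Fintype.card_subtype]
  have := Module.card_eq_pow_finrank (K := F) (V := U)
  exact this.le.trans (Nat.pow_le_pow_right Fintype.card_pos h)

/-- A walk along a reduced word meets a coincidence with probability at most its length times
`q ^ m / L`, even when weighted by a function `f` whose mean is under control after every further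
prescription: as long as there is no coincidence, the next letter acts outside its domain. -/
lemma sum_coincidence_mul_le {M L : ℕ} (hL : OrbitBound ρ M L) (f : (Fin k → G) → ℕ)
    {K B m : ℕ} (hm : m ≤ M)
    (hf : ∀ (X : Finset (Fin k → G)) (D : Fin k × Bool → Submodule F V), IsPrescribed ρ X D →
      ∀ U : Submodule F V, (∀ t, D t ≤ U) → finrank F U ≤ m → (∑ x ∈ X, f x) * K ≤ B * #X) :
    ∀ (l : List (Fin k × Bool)) (X : Finset (Fin k → G)) (D : Fin k × Bool → Submodule F V)
      (U : Submodule F V) (u : V), IsPrescribed ρ X D → FreeGroup.IsReduced l →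
      (∀ t, D t ≤ U ⊔ F ∙ u) → (∀ s ∈ l.head?, D s ≤ U) → u ∉ U →
      finrank F U + 1 + l.length ≤ m →
      (∑ x ∈ X with Coincidence ρ x U u l, f x) * K * L
        ≤ l.length * Fintype.card F ^ m * B * #X := by
  intro l
  induction l with
  | nil =>
    intro X D U u _ _ _ _ _ _
    have : ({x ∈ X | Coincidence ρ x U u []} : Finset (Fin k → G)) = ∅ :=
      filter_eq_empty_iff.2 fun x _ h => h
    simp [this]
  | cons s l ih =>
    intro X D U u hX hl hD hs hu hdim
    have hsU := hs s (by simp)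
    simp only [List.length_cons] at hdim ⊢
    set U' := U ⊔ F ∙ u with hU'
    have hU'dim : finrank F U' ≤ finrank F U + 1 := finrank_sup_span_singleton_le U u
    set Y : V → Finset (Fin k → G) := fun y => {x ∈ X | ρ (letterVal x s) u = y} with hY
    have hsplit : ∀ (P : (Fin k → G) → Prop) (g : (Fin k → G) → ℕ),
        ∑ x ∈ X with P x, g x = ∑ y, ∑ x ∈ Y y with P x, g x := by
      intro P g
      rw [← sum_fiberwise ({x ∈ X | P x}) (fun x => ρ (letterVal x s) u)]
      refine sum_congr rfl fun y _ => sum_congr ?_ fun _ _ => rfl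
      ext x; simp only [hY, mem_filter]; tauto
    have hcardX : #X = ∑ y, #(Y y) :=
      card_eq_sum_card_fiberwise (f := fun x => ρ (letterVal x s) u) (t := univ) (by simp)
    have hDM : finrank F (D s) ≤ M :=
      (Submodule.finrank_mono hsU).trans (by omega)
    have hfib : ∀ y, #(Y y) * L ≤ #X := fun y =>
      hX.card_fiber_mul_le hL hDM (fun h => hu (hsU h)) y
    have huU' : u ∈ U' := Submodule.mem_sup_right (Submodule.mem_span_singleton_self u)
    -- domains after the step
    set D' : V → Fin k × Bool → Submodule F V := fun y r =>
      if r = s then D r ⊔ F ∙ u else if r = (s.1, !s.2) then D r ⊔ F ∙ y else D r with hD'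
    have hYp : ∀ y, IsPrescribed ρ (Y y) (D' y) := fun y => hX.extend s u y
    have hD'le : ∀ y t, D' y t ≤ U' ⊔ F ∙ y := by
      intro y t
      simp only [hD']
      split_ifs
      · exact sup_le ((hD t).trans le_sup_left)
          ((Submodule.span_singleton_le_iff_mem _ _).2 (Submodule.mem_sup_left huU'))
      · exact sup_le_sup_right (hD t) _
      · exact (hD t).trans le_sup_left
    rw [hsplit, sum_mul, sum_mul]
    have hy1 : ∀ y ∈ U', (∑ x ∈ Y y with Coincidence ρ x U u (s :: l), f x) * K * L
        ≤ B * #X := by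
      intro y hy
      have h1 : (∑ x ∈ Y y with Coincidence ρ x U u (s :: l), f x) ≤ ∑ x ∈ Y y, f x :=
        sum_le_sum_of_subset (filter_subset _ _)
      have h2 := hf _ _ (hYp y) U' (fun t => (hD'le y t).trans
        (sup_le le_rfl ((Submodule.span_singleton_le_iff_mem _ _).2 hy))) (by omega)
      calc _ ≤ (∑ x ∈ Y y, f x) * K * L := by gcongr
        _ ≤ B * #(Y y) * L := by gcongr
        _ = B * (#(Y y) * L) := by ring
        _ ≤ B * #X := Nat.mul_le_mul_left _ (hfib y)
    have hy2 : ∀ y, y ∉ U' → (∑ x ∈ Y y with Coincidence ρ x U u (s :: l), f x) * K * L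
        ≤ l.length * Fintype.card F ^ m * B * #(Y y) := by
      intro y hy
      have h1 : ({x ∈ Y y | Coincidence ρ x U u (s :: l)} : Finset (Fin k → G))
          = {x ∈ Y y | Coincidence ρ x U' y l} := by
        refine filter_congr fun x hx => ?_
        have hxy := (mem_filter.1 hx).2
        simp only [Coincidence, hxy]
        exact ⟨fun h => h.resolve_left hy, Or.inr⟩
      rw [h1]
      refine ih (Y y) (D' y) U' y (hYp y) ?_ (hD'le y) ?_ hy (by omega)
      · exact (List.isChain_cons.1 hl).2
      · intro r hr
        have hrs : s.1 = r.1 → s.2 = r.2 := (List.isChain_cons.1 hl).1 r hr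
        have hne : r ≠ (s.1, !s.2) := by
          rintro rfl
          simp at hrs
        simp only [hD', if_neg hne]
        split_ifs
        · exact sup_le (hD r) ((Submodule.span_singleton_le_iff_mem _ _).2 huU')
        · exact hD r
    rw [← sum_filter_add_sum_filter_not univ (fun y => y ∈ U')]
    have e1 : ∑ y with y ∈ U', (∑ x ∈ Y y with Coincidence ρ x U u (s :: l), f x) * K * L
        ≤ Fintype.card F ^ m * (B * #X) := by
      refine (sum_le_card_nsmul _ _ (B * #X) fun y hy => hy1 y (mem_filter.1 hy).2).trans ?_
      rw [smul_eq_mul]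
      exact Nat.mul_le_mul_right _ (card_mem_le_pow U' (by omega))
    have e2 : ∑ y with ¬ y ∈ U', (∑ x ∈ Y y with Coincidence ρ x U u (s :: l), f x) * K * L
        ≤ l.length * Fintype.card F ^ m * B * #X := by
      rw [hcardX, mul_sum]
      refine (sum_le_sum fun y hy => hy2 y (mem_filter.1 hy).2).trans ?_
      exact sum_le_sum_of_subset (filter_subset _ _)
    calc _ ≤ Fintype.card F ^ m * (B * #X) + l.length * Fintype.card F ^ m * B * #X :=
          Nat.add_le_add e1 e2
      _ = _ := by ring

/-- Moment bound: if every vector `v` with `P x v` outside any given subspace forces a coincidence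
along the reduced word `l`, then the `r`-th moment of the number of such `v` is at most the
`r`-th power of `q ^ M + |V| * |l| * q ^ M / L`. The vectors counted by the moment are revealed
one after the other; each of them adds at most `|l| + 1` to the dimension of what is known. -/
lemma sum_pow_card_mul_le {M L : ℕ} (hL : OrbitBound ρ M L) {l : List (Fin k × Bool)}
    (hl : FreeGroup.IsReduced l) (P : (Fin k → G) → V → Prop)
    (hP : ∀ x v (U : Submodule F V), v ∉ U → P x v → Coincidence ρ x U v l) :
    ∀ (r : ℕ) (X : Finset (Fin k → G)) (D : Fin k × Bool → Submodule F V)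
      (U : Submodule F V), IsPrescribed ρ X D → (∀ t, D t ≤ U) →
      finrank F U + r * (l.length + 1) ≤ M →
      (∑ x ∈ X, #{v | P x v} ^ r) * L ^ r ≤
        (Fintype.card F ^ M * L + Fintype.card V * (l.length * Fintype.card F ^ M)) ^ r * #X := by
  intro r
  induction r with
  | zero => intros; simp
  | succ r ih =>
    intro X D U hX hD hdim
    set A := Fintype.card F ^ M * L + Fintype.card V * (l.length * Fintype.card F ^ M) with hA
    have hm : finrank F U + 1 + l.length + r * (l.length + 1) ≤ M := by
      have : (r + 1) * (l.length + 1) = r * (l.length + 1) + l.length + 1 := by ring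
      omega
    set f : (Fin k → G) → ℕ := fun x => #{v | P x v} ^ r with hf
    have hexp : ∑ x ∈ X, #{v | P x v} ^ (r + 1) = ∑ v, ∑ x ∈ X with P x v, f x := by
      have : ∀ x ∈ X, #{v | P x v} ^ (r + 1) = ∑ v, if P x v then f x else 0 := by
        intro x _
        rw [← sum_filter, sum_const, smul_eq_mul, pow_succ, mul_comm]
      rw [sum_congr rfl this, sum_comm]
      exact sum_congr rfl fun v _ => (sum_filter _ _).symm
    have h1 : ∀ v ∈ U, (∑ x ∈ X with P x v, f x) * L ^ (r + 1) ≤ A ^ r * #X * L := by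
      intro v _
      have := ih X D U hX hD (by omega)
      calc _ ≤ (∑ x ∈ X, f x) * L ^ (r + 1) := by
            gcongr; exact filter_subset _ _
        _ = (∑ x ∈ X, f x) * L ^ r * L := by ring
        _ ≤ _ := by gcongr
    have h2 : ∀ v, v ∉ U → (∑ x ∈ X with P x v, f x) * L ^ (r + 1)
        ≤ l.length * Fintype.card F ^ M * A ^ r * #X := by
      intro v hv
      have h3 := sum_coincidence_mul_le hL f (K := L ^ r) (B := A ^ r)
        (m := finrank F U + 1 + l.length) (by omega)
        (fun X' D' hX' U' hD' hU' => ih X' D' U' hX' hD' (by omega)) l X D U v hX hl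
        (fun t => (hD t).trans le_sup_left) (fun s _ => hD s) hv le_rfl
      calc _ ≤ (∑ x ∈ X with Coincidence ρ x U v l, f x) * L ^ (r + 1) := by
            gcongr with x hx
            exact hP x v U hv
        _ = (∑ x ∈ X with Coincidence ρ x U v l, f x) * L ^ r * L := by ring
        _ ≤ _ := h3
        _ ≤ _ := by
            gcongr
            · exact Fintype.card_pos
            · omega
    rw [hexp, sum_mul, ← sum_filter_add_sum_filter_not univ (fun v => v ∈ U)]
    have e1 : ∑ v with v ∈ U, (∑ x ∈ X with P x v, f x) * L ^ (r + 1)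
        ≤ Fintype.card F ^ M * (A ^ r * #X * L) := by
      refine (sum_le_card_nsmul _ _ _ fun v hv => h1 v (mem_filter.1 hv).2).trans ?_
      rw [smul_eq_mul]
      exact Nat.mul_le_mul_right _ (card_mem_le_pow U (by omega))
    have e2 : ∑ v with ¬ v ∈ U, (∑ x ∈ X with P x v, f x) * L ^ (r + 1)
        ≤ Fintype.card V * (l.length * Fintype.card F ^ M * A ^ r * #X) := by
      refine (sum_le_card_nsmul _ _ _ fun v hv => h2 v (mem_filter.1 hv).2).trans ?_
      rw [smul_eq_mul]
      exact Nat.mul_le_mul_right _ (card_le_univ _)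
    calc _ ≤ _ := Nat.add_le_add e1 e2
      _ = A ^ (r + 1) * #X := by rw [hA]; ring

omit [Fintype F] [Fintype V] [Fintype G] in
/-- Without a coincidence the end point of a walk is independent of the earlier vectors. -/
lemma notMem_of_not_coincidence (x : Fin k → G) :
    ∀ (l : List (Fin k × Bool)) (U : Submodule F V) (u : V), u ∉ U → ¬ Coincidence ρ x U u l →
      l ≠ [] →
      ρ ((l.map (letterVal x)).reverse.prod) u ∉
        U ⊔ Submodule.span F {y | ∃ a b, l = a ++ b ∧ b ≠ [] ∧
          y = ρ ((a.map (letterVal x)).reverse.prod) u} := by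
  intro l
  induction l with
  | nil => intro _ _ _ _ h; exact absurd rfl h
  | cons s l ih =>
    intro U u hu hc _
    simp only [Coincidence, not_or] at hc
    have hset : ∀ y, (∃ a b, s :: l = a ++ b ∧ b ≠ [] ∧
          y = ρ ((a.map (letterVal x)).reverse.prod) u) →
        y = u ∨ ∃ a b, l = a ++ b ∧ b ≠ [] ∧
          y = ρ ((a.map (letterVal x)).reverse.prod) (ρ (letterVal x s) u) := by
      rintro y ⟨a, b, hab, hb, rfl⟩
      cases a with
      | nil => left; simp
      | cons a0 a =>
        simp only [List.cons_append, List.cons.injEq] at hab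
        obtain ⟨rfl, hab⟩ := hab
        right
        exact ⟨a, b, hab, hb, by simp⟩
    rcases eq_or_ne l [] with rfl | hl
    · intro hmem
      apply hc.1
      have : Submodule.span F {y | ∃ a b, [s] = a ++ b ∧ b ≠ [] ∧
          y = ρ ((a.map (letterVal x)).reverse.prod) u} ≤ F ∙ u := by
        refine Submodule.span_mono ?_
        intro y hy
        rcases hset y hy with h | ⟨a, b, hab, hb, _⟩
        · exact h
        · exact absurd (List.nil_eq_append_iff.1 hab).2 hb
      simpa using sup_le_sup_left this U hmem
    · have := ih _ _ hc.1 hc.2 hl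
      intro hmem
      apply this
      simp only [List.map_cons, List.reverse_cons, List.prod_append, List.prod_singleton, map_mul,
        Module.End.mul_apply] at hmem
      refine (sup_le (le_sup_left.trans le_sup_left) (Submodule.span_le.2 ?_) :
        U ⊔ _ ≤ _) hmem
      intro y hy
      rcases hset y hy with rfl | h
      · exact Submodule.mem_sup_left (Submodule.mem_sup_right (Submodule.mem_span_singleton_self _))
      · exact Submodule.mem_sup_right (Submodule.subset_span h)

end Trajectories

/-! ### Orbits of pointwise stabilizers: linear, symplectic and unitary groups -/

section Orbits

open Module

variable {F : Type*} [Field F]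

section Perp

variable {V : Type*} [AddCommGroup V] [Module F V] {θ : F →+* F}

/-- The right orthogonal complement of `W` with respect to a sesquilinear form. -/
def perp (f : V →ₗ[F] V →ₛₗ[θ] F) (W : Submodule F V) : Submodule F V :=
  W.dualAnnihilator.comap f.flip

lemma mem_perp {f : V →ₗ[F] V →ₛₗ[θ] F} {W : Submodule F V} {a : V} :
    a ∈ perp f W ↔ ∀ w ∈ W, f w a = 0 := by
  simp [perp, Submodule.mem_dualAnnihilator]

lemma mem_perp_sup_span {f : V →ₗ[F] V →ₛₗ[θ] F} {W : Submodule F V} {u a : V} :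
    a ∈ perp f (W ⊔ F ∙ u) ↔ a ∈ perp f W ∧ f u a = 0 := by
  simp only [mem_perp]
  constructor
  · exact fun h => ⟨fun w hw => h w (Submodule.mem_sup_left hw),
      h u (Submodule.mem_sup_right (Submodule.mem_span_singleton_self u))⟩
  · rintro ⟨h1, h2⟩ w hw
    obtain ⟨a, ha, b, hb, rfl⟩ := Submodule.mem_sup.1 hw
    obtain ⟨c, rfl⟩ := Submodule.mem_span_singleton.1 hb
    simp [h1 a ha, h2]

variable [Finite F] [Module.Finite F V] {f : V →ₗ[F] V →ₛₗ[θ] F}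

/-- A nondegenerate sesquilinear form represents every functional, also when the automorphism `θ`
is not trivial: the map `a ↦ f (·, a)` is an injection between finite sets of the same size. -/
lemma bijective_flip (hf : LinearMap.Nondegenerate f) :
    Function.Bijective fun a => (f.flip a : Dual F V) := by
  have : Finite V := Module.finite_of_finite F
  have : Finite (Dual F V) := Module.finite_of_finite F
  refine Function.Injective.bijective_of_nat_card_le ?_ ?_
  · intro a b h
    have h0 : f.flip (a - b) = 0 := by rw [map_sub]; exact sub_eq_zero.2 h
    have := hf.2 (a - b) fun x => by
      rw [← LinearMap.flip_apply, h0, LinearMap.zero_apply]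
    exact sub_eq_zero.1 this
  · rw [natCard_eq_pow_finrank (K := F) (V := Dual F V), natCard_eq_pow_finrank (K := F) (V := V),
      Subspace.dual_finrank_eq]

lemma finrank_perp (hf : LinearMap.Nondegenerate f) (W : Submodule F V) :
    finrank F W + finrank F (perp f W) = finrank F V := by
  have : Finite V := Module.finite_of_finite F
  have e : Nat.card (perp f W) = Nat.card W.dualAnnihilator :=
    Nat.card_congr ((Equiv.ofBijective _ (bijective_flip hf)).subtypeEquiv fun a => Iff.rfl)
  rw [natCard_eq_pow_finrank (K := F) (V := perp f W),
    natCard_eq_pow_finrank (K := F) (V := W.dualAnnihilator)] at e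
  have e' := Nat.pow_right_injective (Finite.one_lt_card : 1 < Nat.card F) e
  rw [e', Subspace.finrank_add_finrank_dualAnnihilator_eq]

lemma finrank_perp_sup_span_ge (hf : LinearMap.Nondegenerate f) (W : Submodule F V) (u : V) :
    finrank F (perp f W) ≤ finrank F (perp f (W ⊔ F ∙ u)) + 1 := by
  have h1 := finrank_perp hf W
  have h2 := finrank_perp hf (W ⊔ F ∙ u)
  have : Finite V := Module.finite_of_finite F
  have h3 : finrank F (W ⊔ F ∙ u : Submodule F V) ≤ finrank F W + 1 :=
    (Submodule.finrank_add_le_finrank_add_finrank _ _).trans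
      (Nat.add_le_add_left ((finrank_span_le_card {u}).trans (by simp)) _)
  omega

/-- A vector outside `W` is not orthogonal to all of the complement of `W`. -/
lemma exists_mem_perp_ne_zero (hf : LinearMap.Nondegenerate f) {W : Submodule F V} {v : V}
    (hv : v ∉ W) : ∃ a ∈ perp f W, f v a ≠ 0 := by
  obtain ⟨φ, h1, h2⟩ := Submodule.exists_le_ker_of_notMem hv
  obtain ⟨a, rfl⟩ := (bijective_flip hf).2 φ
  exact ⟨a, mem_perp.2 fun w hw => h2 hw, h1⟩

/-- A subspace of more than half the dimension is not totally isotropic. -/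
lemma exists_apply_ne_zero (hf : LinearMap.Nondegenerate f) (K : Submodule F V)
    (hK : finrank F V < 2 * finrank F K) : ∃ x ∈ K, ∃ y ∈ K, f x y ≠ 0 := by
  by_contra! h
  have h1 : K ≤ perp f K := fun y hy => mem_perp.2 fun x hx => h x hx y hy
  have := Submodule.finrank_mono h1
  have := finrank_perp hf K
  omega

end Perp

variable {n : ℕ}

/-- The images of `v` under the elements of `G` that fix the subspace `W` pointwise. -/
def stabOrbit (G : Subgroup (GL (Fin n) F)) (W : Submodule F (Fin n → F)) (v : Fin n → F) :
    Set (Fin n → F) :=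
  {y | ∃ g ∈ G, (∀ w ∈ W, g.1 *ᵥ w = w) ∧ g.1 *ᵥ v = y}

/-- The invertible matrix of `x ↦ x + φ x • a`. -/
noncomputable def glTransvection (φ : Dual F (Fin n → F)) (a : Fin n → F) (h : 1 + φ a ≠ 0) :
    GL (Fin n) F :=
  Matrix.GeneralLinearGroup.mkOfDetNeZero (LinearMap.toMatrix' (LinearMap.transvection φ a)) (by
    rw [LinearMap.det_toMatrix', LinearMap.transvection.det]; exact h)

lemma glTransvection_mulVec (φ : Dual F (Fin n → F)) (a : Fin n → F) (h : 1 + φ a ≠ 0)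
    (x : Fin n → F) : (glTransvection φ a h).1 *ᵥ x = x + φ x • a := by
  change (LinearMap.toMatrix' (LinearMap.transvection φ a)) *ᵥ x = _
  rw [LinearMap.toMatrix'_mulVec, LinearMap.transvection.apply]

lemma det_glTransvection (φ : Dual F (Fin n → F)) (a : Fin n → F) (h : 1 + φ a ≠ 0) :
    (glTransvection φ a h).1.det = 1 + φ a := by
  change (LinearMap.toMatrix' (LinearMap.transvection φ a)).det = _
  rw [LinearMap.det_toMatrix', LinearMap.transvection.det]

lemma mem_specialSubgroup {g : GL (Fin n) F} : g ∈ specialSubgroup F n ↔ g.1.det = 1 := by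
  rw [specialSubgroup, MonoidHom.mem_ker, Units.ext_iff]
  rfl

lemma gl_ext {g h : GL (Fin n) F} (H : ∀ x, g.1 *ᵥ x = h.1 *ᵥ x) : g = h :=
  Units.ext (Matrix.mulVec_injective (funext H))

variable [Finite F]

/-- If each vector of `a₀ + S` is a combination of `c` and of the difference `y - v`
for some `y ∈ P`, then `P` is not much smaller than `S`. -/
lemma card_le_card_mul_sq {V : Type*} [AddCommGroup V] [Module F V] [Finite V] (S P : Set V)
    (a₀ v c : V) (h : ∀ u ∈ S, ∃ y ∈ P, ∃ α β : F, a₀ + u = α • (y - v) + β • c) :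
    Nat.card S ≤ Nat.card P * Nat.card F ^ 2 := by
  choose y hy α β hαβ using h
  have : Function.Injective fun u : S => ((⟨y u u.2, hy u u.2⟩ : P), α u u.2, β u u.2) := by
    rintro ⟨u, hu⟩ ⟨u', hu'⟩ heq
    simp only [Prod.mk.injEq, Subtype.mk.injEq] at heq
    have h1 := hαβ u hu
    rw [heq.1, heq.2.1, heq.2.2, ← hαβ u' hu'] at h1
    exact Subtype.ext (add_left_cancel h1)
  have h2 := Nat.card_le_card_of_injective _ this
  rwa [Nat.card_prod, Nat.card_prod, ← sq] at h2

lemma pow_le_card_of_pow_le_mul_sq {e m N : ℕ} (h : Nat.card F ^ e ≤ N * Nat.card F ^ 2)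
    (hm : m + 2 ≤ e) : Nat.card F ^ m ≤ N := by
  refine Nat.le_of_mul_le_mul_right (c := Nat.card F ^ 2) ?_ (pow_pos Nat.card_pos 2)
  rw [← pow_add]
  exact (Nat.pow_le_pow_right Nat.card_pos hm).trans h

lemma stabOrbit_special (W : Submodule F (Fin n → F)) (v : Fin n → F) (hv : v ∉ W)
    (hn : 3 ≤ n) : Nat.card F ^ (n - 3) ≤ Nat.card (stabOrbit (specialSubgroup F n) W v) := by
  obtain ⟨φ, h1, h2⟩ := Submodule.exists_le_ker_of_notMem hv
  have hcard := card_le_card_mul_sq (φ.ker : Set (Fin n → F))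
    (stabOrbit (specialSubgroup F n) W v) 0 v 0 (by
      intro a ha
      have ha : φ a = 0 := ha
      refine ⟨v + φ v • a, ⟨glTransvection φ a (by simp [ha]), ?_, ?_, ?_⟩, (φ v)⁻¹, 0, ?_⟩
      · rw [mem_specialSubgroup, det_glTransvection, ha, add_zero]
      · intro w hw
        rw [glTransvection_mulVec, show φ w = 0 from h2 hw, zero_smul, add_zero]
      · rw [glTransvection_mulVec]
      · rw [add_sub_cancel_left, smul_smul, inv_mul_cancel₀ h1]; simp)
  have hdim : n ≤ finrank F φ.ker + 1 := by
    have h3 := LinearMap.finrank_range_add_finrank_ker φ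
    have h4 := Submodule.finrank_le (LinearMap.range φ)
    rw [Module.finrank_self] at h4
    rw [Module.finrank_fin_fun] at h3
    omega
  have h5 : Nat.card (φ.ker : Set (Fin n → F)) = Nat.card F ^ finrank F φ.ker :=
    natCard_eq_pow_finrank (K := F) (V := φ.ker)
  rw [h5] at hcard
  exact pow_le_card_of_pow_le_mul_sq hcard (by omega)

lemma stabOrbit_symplectic {f : LinearMap.BilinForm F (Fin n → F)} (alt : f.IsAlt)
    (hf : LinearMap.Nondegenerate f) (W : Submodule F (Fin n → F)) (v : Fin n → F) (hv : v ∉ W)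
    (hn : finrank F W + 3 ≤ n) :
    Nat.card F ^ (n - finrank F W - 3) ≤
      Nat.card (stabOrbit (isometryGroup fun u v => f u v) W v) := by
  obtain ⟨a₀, ha₀, hva₀⟩ := exists_mem_perp_ne_zero hf hv
  have hcard := card_le_card_mul_sq (perp f (W ⊔ F ∙ v) : Set (Fin n → F))
    (stabOrbit (isometryGroup fun u v => f u v) W v) a₀ v 0 (by
      intro u hu
      obtain ⟨hu, hvu⟩ := mem_perp_sup_span.1 hu
      have ha : a₀ + u ∈ perp f W := add_mem ha₀ hu
      have hva : f v (a₀ + u) = f v a₀ := by rw [map_add, hvu, add_zero]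
      generalize a₀ + u = a at ha hva
      have haa : f.flip a a = 0 := alt a
      have hT : ∀ x, (glTransvection (f.flip a) a (by rw [haa]; simp)).1 *ᵥ x = x + f x a • a :=
        fun x => glTransvection_mulVec _ _ _ x
      refine ⟨v + f v a • a, ⟨glTransvection (f.flip a) a (by rw [haa]; simp), ?_, ?_, ?_⟩,
        (f v a)⁻¹, 0, ?_⟩
      · intro x y
        rw [hT, hT]
        have h1 : f a a = 0 := alt a
        have h2 : f a y = - f y a := (alt.neg_eq y a).symm
        simp only [map_add, LinearMap.add_apply, map_smul, LinearMap.smul_apply, smul_eq_mul, h1,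
          h2]
        ring
      · intro w hw
        rw [hT, mem_perp.1 ha w hw, zero_smul, add_zero]
      · exact hT v
      · rw [add_sub_cancel_left, smul_smul, inv_mul_cancel₀ (by rwa [hva])]; simp)
  have h5 : Nat.card (perp f (W ⊔ F ∙ v) : Set (Fin n → F))
      = Nat.card F ^ finrank F (perp f (W ⊔ F ∙ v)) :=
    natCard_eq_pow_finrank (K := F) (V := perp f (W ⊔ F ∙ v))
  rw [h5] at hcard
  have h6 := finrank_perp_sup_span_ge hf W v
  have h7 := finrank_perp hf W
  rw [Module.finrank_fin_fun] at h7
  exact pow_le_card_of_pow_le_mul_sq hcard (by omega)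

section Unitary

variable {θ : F →+* F} {f : (Fin n → F) →ₗ[F] (Fin n → F) →ₛₗ[θ] F}

/-- A subspace of more than half the dimension contains a nonisotropic vector of a hermitian
form. -/
lemma exists_hermitian_self_ne_zero (hθ : θ ≠ RingHom.id F) (herm : ∀ u v, f v u = θ (f u v))
    (hf : LinearMap.Nondegenerate f) (K : Submodule F (Fin n → F)) (hK : n < 2 * finrank F K) :
    ∃ z ∈ K, f z z ≠ 0 := by
  obtain ⟨x, hx, y, hy, hxy⟩ := exists_apply_ne_zero hf K (by rwa [Module.finrank_fin_fun])
  by_contra! h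
  have hpol : ∀ c : F, c * f x y + θ (c * f x y) = 0 := by
    intro c
    have h1 := h (c • x + y) (add_mem (K.smul_mem c hx) hy)
    have h2 := h x hx
    have h3 := h y hy
    have h4 := herm x y
    simp only [map_add, LinearMap.add_apply, map_smul, LinearMap.smul_apply, smul_eq_mul, h2, h3,
      LinearMap.map_smulₛₗ, h4] at h1
    rw [map_mul]
    linear_combination h1
  apply hθ
  ext c
  have h1 := hpol c
  have h2 := hpol 1
  rw [map_mul] at h1
  rw [one_mul] at h2
  have h3 : (c - θ c) * f x y = 0 := by linear_combination h1 - θ c * h2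
  have := (mul_eq_zero.1 h3).resolve_right hxy
  exact (sub_eq_zero.1 this).symm

omit [Finite F] in
/-- The determinant `1 + c t` of an isometric quasi-reflection has norm one. -/
lemma one_add_mul_norm {c t : F} (ht : θ t = t) (hc : c + θ c + c * θ c * t = 0) :
    (1 + c * t) * θ (1 + c * t) = 1 := by
  rw [map_add, map_mul, map_one, ht]
  linear_combination t * hc

/-- The quasi-reflection (or transvection, if `a` is isotropic) `x ↦ x + c f(x, a) a`. -/
noncomputable def quasiReflection (f : (Fin n → F) →ₗ[F] (Fin n → F) →ₛₗ[θ] F)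
    (a : Fin n → F) (c : F) (h : 1 + c * f a a ≠ 0) : GL (Fin n) F :=
  glTransvection (f.flip a) (c • a) (by simpa using h)

omit [Finite F] in
lemma quasiReflection_mulVec {a : Fin n → F} {c : F} (h : 1 + c * f a a ≠ 0) (x : Fin n → F) :
    (quasiReflection f a c h).1 *ᵥ x = x + (c * f x a) • a := by
  rw [quasiReflection, glTransvection_mulVec, LinearMap.flip_apply, smul_smul, mul_comm]

omit [Finite F] in
lemma det_quasiReflection {a : Fin n → F} {c : F} (h : 1 + c * f a a ≠ 0) :
    (quasiReflection f a c h).1.det = 1 + c * f a a := by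
  rw [quasiReflection, det_glTransvection, LinearMap.flip_apply]
  simp

omit [Finite F] in
lemma quasiReflection_mem_isometryGroup (herm : ∀ u v, f v u = θ (f u v)) {a : Fin n → F} {c : F}
    (h : 1 + c * f a a ≠ 0) (hc : c + θ c + c * θ c * f a a = 0) :
    quasiReflection f a c h ∈ isometryGroup fun u v => f u v := by
  intro x y
  rw [quasiReflection_mulVec, quasiReflection_mulVec]
  have h1 := herm y a
  simp only [map_add, LinearMap.add_apply, map_smul, LinearMap.smul_apply, smul_eq_mul,
    LinearMap.map_smulₛₗ, map_mul, ← h1]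
  linear_combination f x a * f a y * hc

omit [Finite F] in
/-- Every vector is the centre of a nontrivial quasi-reflection or transvection. -/
lemma exists_quasiReflection_coeff (hθ : θ ≠ RingHom.id F) (inv : ∀ x, θ (θ x) = x) {t : F}
    (ht : θ t = t) : ∃ c : F, c ≠ 0 ∧ c + θ c + c * θ c * t = 0 := by
  obtain ⟨b, hb⟩ : ∃ b, θ b ≠ b := by
    by_contra! h
    exact hθ (RingHom.ext h)
  have hb0 : θ b ≠ 0 := by
    intro h
    apply hb
    rw [h, ← inv b, h, map_zero]
  rcases eq_or_ne t 0 with rfl | h0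
  · refine ⟨b - θ b, sub_ne_zero.2 hb.symm, ?_⟩
    rw [map_sub, inv]; ring
  · have hb1 : b ≠ 0 := by rintro rfl; simp at hb
    refine ⟨(b / θ b - 1) / t, ?_, ?_⟩
    · refine div_ne_zero (sub_ne_zero.2 fun h => hb ?_) h0
      rw [div_eq_one_iff_eq hb0] at h
      exact h.symm
    · rw [map_div₀, map_sub, map_div₀, inv, ht, map_one]
      field_simp
      ring

lemma stabOrbit_unitary (hθ : θ ≠ RingHom.id F) (inv : ∀ x, θ (θ x) = x)
    (herm : ∀ u v, f v u = θ (f u v)) (hf : LinearMap.Nondegenerate f)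
    (W : Submodule F (Fin n → F)) (v : Fin n → F) (hv : v ∉ W) (hn : 2 * finrank F W + 3 ≤ n) :
    Nat.card F ^ (n - finrank F W - 3) ≤
      Nat.card (stabOrbit ((isometryGroup fun u v => f u v) ⊓ specialSubgroup F n) W v) := by
  obtain ⟨a₀, ha₀, hva₀⟩ := exists_mem_perp_ne_zero hf hv
  have h6 := finrank_perp_sup_span_ge hf W v
  have h7 := finrank_perp hf W
  rw [Module.finrank_fin_fun] at h7
  -- a fixed quasi-reflection centre `z` serves to correct determinants
  obtain ⟨z, hz, hzz⟩ := exists_hermitian_self_ne_zero hθ herm hf (perp f (W ⊔ F ∙ v)) (by omega)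
  obtain ⟨hzW, hvz⟩ := mem_perp_sup_span.1 hz
  have hcard := card_le_card_mul_sq (perp f (W ⊔ F ∙ v) : Set (Fin n → F))
    (stabOrbit ((isometryGroup fun u v => f u v) ⊓ specialSubgroup F n) W v) a₀ v 0 (by
      intro u hu
      obtain ⟨hu, hvu⟩ := mem_perp_sup_span.1 hu
      have ha : a₀ + u ∈ perp f W := add_mem ha₀ hu
      have hva : f v (a₀ + u) = f v a₀ := by rw [map_add, hvu, add_zero]
      generalize a₀ + u = a at ha hva
      have hta := (herm a a).symm
      have htz := (herm z z).symm
      obtain ⟨c, hc0, hc⟩ := exists_quasiReflection_coeff hθ inv hta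
      have hN := one_add_mul_norm hta hc
      have hc1 : 1 + c * f a a ≠ 0 := left_ne_zero_of_mul_eq_one hN
      set η := θ (1 + c * f a a) with hη
      have hη' : θ η = 1 + c * f a a := inv _
      have hηd : 1 + (η - 1) / f z z * f z z = η := by field_simp; ring
      have hd : (η - 1) / f z z + θ ((η - 1) / f z z) +
          (η - 1) / f z z * θ ((η - 1) / f z z) * f z z = 0 := by
        rw [map_div₀, map_sub, hη', htz, map_one]
        field_simp
        linear_combination hN
      have hd1 : 1 + (η - 1) / f z z * f z z ≠ 0 := by
        rw [hηd]; exact right_ne_zero_of_mul_eq_one hN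
      have hT : ∀ x, (quasiReflection f a c hc1 * quasiReflection f z _ hd1).1 *ᵥ x =
          (quasiReflection f a c hc1).1 *ᵥ ((quasiReflection f z _ hd1).1 *ᵥ x) := by
        intro x; rw [Units.val_mul, mulVec_mulVec]
      refine ⟨v + (c * f v a) • a, ⟨quasiReflection f a c hc1 * quasiReflection f z _ hd1,
        ⟨mul_mem (quasiReflection_mem_isometryGroup herm hc1 hc)
          (quasiReflection_mem_isometryGroup herm hd1 hd), ?_⟩, ?_, ?_⟩, (c * f v a)⁻¹, 0, ?_⟩
      · change _ ∈ specialSubgroup F n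
        rw [mem_specialSubgroup, Units.val_mul, det_mul, det_quasiReflection, det_quasiReflection,
          hηd, hN]
      · intro w hw
        rw [hT, quasiReflection_mulVec hd1, mem_perp.1 hzW w hw, mul_zero, zero_smul, add_zero,
          quasiReflection_mulVec, mem_perp.1 ha w hw, mul_zero, zero_smul, add_zero]
      · rw [hT, quasiReflection_mulVec hd1, hvz, mul_zero, zero_smul, add_zero,
          quasiReflection_mulVec]
      · rw [add_sub_cancel_left, smul_smul, inv_mul_cancel₀ (mul_ne_zero hc0 (by rwa [hva]))]
        simp)
  have h5 : Nat.card (perp f (W ⊔ F ∙ v) : Set (Fin n → F))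
      = Nat.card F ^ finrank F (perp f (W ⊔ F ∙ v)) :=
    natCard_eq_pow_finrank (K := F) (V := perp f (W ⊔ F ∙ v))
  rw [h5] at hcard
  exact pow_le_card_of_pow_le_mul_sq hcard (by omega)

end Unitary

end Orbits

/-! ### Orbits of pointwise stabilizers: the groups `Ω` -/

section Orthogonal

open Module
open scoped commutatorElement

variable {F : Type*} [Field F] {n : ℕ} (Q : QuadraticForm F (Fin n → F))

lemma polarBilin_self (a : Fin n → F) : Q.polarBilin a a = 2 * Q a := by
  simp [QuadraticMap.polar_self, two_mul]

lemma polarBilin_comm (a b : Fin n → F) : Q.polarBilin a b = Q.polarBilin b a := by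
  simp [QuadraticMap.polar_comm]

lemma quadraticForm_add (a b : Fin n → F) : Q (a + b) = Q a + Q b + Q.polarBilin a b := by
  simp [QuadraticMap.polar]

variable {Q}

/-- The reflection `x ↦ x - B(a, x) / Q(a) • a`, where `B` is the polar form of `Q`. In
characteristic two it is an orthogonal transvection. -/
noncomputable def quadraticReflection {a : Fin n → F} (h : Q a ≠ 0) : GL (Fin n) F :=
  glTransvection (-(Q a)⁻¹ • Q.polarBilin a) a (by
    rw [LinearMap.smul_apply, polarBilin_self, smul_eq_mul]
    field_simp
    norm_num)

lemma quadraticReflection_mulVec {a : Fin n → F} (h : Q a ≠ 0) (x : Fin n → F) :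
    (quadraticReflection h).1 *ᵥ x = x - (Q.polarBilin a x / Q a) • a := by
  rw [quadraticReflection, glTransvection_mulVec, LinearMap.smul_apply, smul_eq_mul, neg_mul,
    neg_smul, ← sub_eq_add_neg, div_eq_inv_mul]

lemma det_quadraticReflection {a : Fin n → F} (h : Q a ≠ 0) :
    (quadraticReflection h).1.det = -1 := by
  rw [quadraticReflection, det_glTransvection, LinearMap.smul_apply, polarBilin_self, smul_eq_mul]
  field_simp
  norm_num

lemma quadraticReflection_mem {a : Fin n → F} (h : Q a ≠ 0) :
    quadraticReflection h ∈ orthogonalGroup Q := by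
  intro x
  rw [quadraticReflection_mulVec, sub_eq_add_neg, ← neg_smul, quadraticForm_add,
    QuadraticMap.map_smul, map_smul, polarBilin_comm Q x a, smul_eq_mul, smul_eq_mul]
  field_simp
  ring

lemma quadraticReflection_mul_self {a : Fin n → F} (h : Q a ≠ 0) :
    quadraticReflection h * quadraticReflection h = 1 := by
  refine gl_ext fun x => ?_
  rw [Units.val_mul, ← mulVec_mulVec, quadraticReflection_mulVec, quadraticReflection_mulVec,
    map_sub, map_smul, polarBilin_self, smul_eq_mul, Units.val_one, one_mulVec, sub_sub, ← add_smul]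
  have : Q.polarBilin a x / Q a + (Q.polarBilin a x - Q.polarBilin a x / Q a * (2 * Q a)) / Q a
      = 0 := by field_simp; ring
  rw [this, zero_smul, sub_zero]

lemma quadraticReflection_mul_comm {a z : Fin n → F} (ha : Q a ≠ 0) (hz : Q z ≠ 0)
    (haz : Q.polarBilin a z = 0) :
    quadraticReflection ha * quadraticReflection hz =
      quadraticReflection hz * quadraticReflection ha := by
  refine gl_ext fun x => ?_
  have hza : Q.polarBilin z a = 0 := by rw [polarBilin_comm, haz]
  rw [Units.val_mul, Units.val_mul, ← mulVec_mulVec, ← mulVec_mulVec]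
  simp only [quadraticReflection_mulVec, map_sub, map_smul, haz, hza, smul_zero, sub_zero]
  abel

lemma commutator_mul_involutions {H : Type*} [Group H] {a c z : H} (ha : a * a = 1)
    (hc : c * c = 1) (hz : z * z = 1) (haz : a * z = z * a) (hcz : c * z = z * c) :
    ⁅a * z, c * z⁆ = a * c * a * c := by
  have ha' : a⁻¹ = a := inv_eq_of_mul_eq_one_left ha
  have hc' : c⁻¹ = c := inv_eq_of_mul_eq_one_left hc
  have hz' : z⁻¹ = z := inv_eq_of_mul_eq_one_left hz
  rw [commutatorElement_def, _root_.mul_inv_rev, _root_.mul_inv_rev, ha', hc', hz']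
  calc a * z * (c * z) * (z * a) * (z * c) = a * z * c * (z * z) * a * z * c := by group
    _ = a * (z * c) * (a * z) * c := by rw [hz]; group
    _ = a * c * (z * z) * a * c := by rw [← hcz, haz]; group
    _ = a * c * a * c := by rw [hz]; group

variable [Finite F]

/-- A subspace of more than half the dimension is not totally singular. -/
lemma exists_quadraticForm_ne_zero (hQ : LinearMap.Nondegenerate Q.polarBilin)
    (K : Submodule F (Fin n → F)) (hK : n < 2 * finrank F K) : ∃ z ∈ K, Q z ≠ 0 := by
  by_contra! h
  obtain ⟨x, hx, y, hy, hxy⟩ := exists_apply_ne_zero hQ K (by rwa [Module.finrank_fin_fun])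
  apply hxy
  have := quadraticForm_add Q x y
  rw [h x hx, h y hy, h _ (add_mem hx hy)] at this
  simpa using this.symm

/-- The square of a product of two reflections lies in `Ω`: it is the commutator of `r_a r_z` and
`r_c r_z`, both of determinant one, for any nonsingular `z` orthogonal to `a` and `c`. -/
lemma mul_reflections_mem_omega (hQ : LinearMap.Nondegenerate Q.polarBilin) (hn : 5 ≤ n)
    {a c : Fin n → F} (ha : Q a ≠ 0) (hc : Q c ≠ 0) :
    quadraticReflection ha * quadraticReflection hc * quadraticReflection ha *
      quadraticReflection hc ∈
      ⁅orthogonalGroup Q ⊓ specialSubgroup F n, orthogonalGroup Q ⊓ specialSubgroup F n⁆ := by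
  have h1 := finrank_perp hQ ⊥
  have h2 := finrank_perp_sup_span_ge hQ ⊥ a
  have h3 := finrank_perp_sup_span_ge hQ (⊥ ⊔ F ∙ a) c
  rw [Module.finrank_fin_fun, finrank_bot] at h1
  obtain ⟨z, hz, hQz⟩ := exists_quadraticForm_ne_zero hQ (perp Q.polarBilin (⊥ ⊔ F ∙ a ⊔ F ∙ c))
    (by omega)
  obtain ⟨hz, hcz⟩ := mem_perp_sup_span.1 hz
  obtain ⟨-, haz⟩ := mem_perp_sup_span.1 hz
  rw [← commutator_mul_involutions (quadraticReflection_mul_self ha)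
    (quadraticReflection_mul_self hc) (quadraticReflection_mul_self hQz)
    (quadraticReflection_mul_comm ha hQz haz) (quadraticReflection_mul_comm hc hQz hcz)]
  have key : ∀ {b : Fin n → F} (hb : Q b ≠ 0), quadraticReflection hb * quadraticReflection hQz ∈
      orthogonalGroup Q ⊓ specialSubgroup F n := by
    intro b hb
    refine ⟨mul_mem (quadraticReflection_mem hb) (quadraticReflection_mem hQz), ?_⟩
    change _ ∈ specialSubgroup F n
    rw [mem_specialSubgroup, Units.val_mul, det_mul, det_quadraticReflection,
      det_quadraticReflection]
    norm_num
  exact Subgroup.commutator_mem_commutator (key ha) (key hc)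

/-- On the orthogonal complement of `W` the form often takes a value other than `-s`: if it takes
the value `-s` at `u₁`, then it cannot take that value both at `u` and at `u + u₁` when `u` is
orthogonal to `u₁`. -/
lemma card_quadraticForm_ne (hQ : LinearMap.Nondegenerate Q.polarBilin)
    (W : Submodule F (Fin n → F)) {s : F} (hs : s ≠ 0) {m : ℕ} (hm : finrank F W + m + 2 ≤ n) :
    Nat.card F ^ m ≤ Nat.card {u | u ∈ perp Q.polarBilin W ∧ Q u ≠ -s} := by
  set S : Set (Fin n → F) := {u | u ∈ perp Q.polarBilin W ∧ Q u ≠ -s} with hS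
  have hfin : Finite (Fin n → F) := inferInstance
  have hdim := finrank_perp hQ W
  rw [Module.finrank_fin_fun] at hdim
  by_cases hall : ∀ u ∈ perp Q.polarBilin W, Q u ≠ -s
  · have h1 : Nat.card (perp Q.polarBilin W) ≤ Nat.card S :=
      Nat.card_mono (Set.toFinite S) fun u hu => ⟨hu, hall u hu⟩
    rw [natCard_eq_pow_finrank (K := F)] at h1
    exact (Nat.pow_le_pow_right Nat.card_pos (by omega)).trans h1
  · push Not at hall
    obtain ⟨u₁, hu₁, hQu₁⟩ := hall
    set T := perp Q.polarBilin (W ⊔ F ∙ u₁) with hT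
    have h2 : _ ≤ finrank F T + 1 := finrank_perp_sup_span_ge hQ W u₁
    have hsub : (T : Set (Fin n → F)) ⊆ S ∪ (fun u => u - u₁) '' S := by
      intro u hu
      obtain ⟨huW, hu1⟩ := mem_perp_sup_span.1 hu
      by_cases h : Q u = -s
      · refine Or.inr ⟨u + u₁, ⟨add_mem huW hu₁, ?_⟩, by simp⟩
        rw [quadraticForm_add, h, hQu₁, polarBilin_comm, hu1, add_zero]
        intro h3
        apply hs
        linear_combination -h3
      · exact Or.inl ⟨huW, h⟩
    have h3 : Nat.card T ≤ Nat.card S + Nat.card S := by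
      have e1 : (T : Set (Fin n → F)).ncard ≤ _ := Set.ncard_le_ncard hsub (Set.toFinite _)
      have e2 := Set.ncard_union_le S ((fun u => u - u₁) '' S)
      have e3 := Set.ncard_image_le (f := fun u => u - u₁) (Set.toFinite S)
      have : Nat.card T = (T : Set (Fin n → F)).ncard := rfl
      have : Nat.card S = S.ncard := rfl
      omega
    rw [natCard_eq_pow_finrank (K := F)] at h3
    have h4 : Nat.card F ^ (m + 1) ≤ Nat.card F ^ finrank F T :=
      Nat.pow_le_pow_right Nat.card_pos (by omega)
    have h5 : 2 ≤ Nat.card F := Finite.one_lt_card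
    have h6 : Nat.card F ^ m * 2 ≤ Nat.card F ^ (m + 1) := by
      rw [pow_succ]; exact Nat.mul_le_mul_left _ h5
    omega

lemma stabOrbit_omega (hQ : LinearMap.Nondegenerate Q.polarBilin)
    (W : Submodule F (Fin n → F)) (v : Fin n → F) (hv : v ∉ W) (hn : 21 ≤ n)
    (hW : 10 * finrank F W ≤ n) :
    Nat.card F ^ (n - finrank F W - 7) ≤
      Nat.card (stabOrbit ⁅orthogonalGroup Q ⊓ specialSubgroup F n,
        orthogonalGroup Q ⊓ specialSubgroup F n⁆ W v) := by
  set B : LinearMap.BilinForm F (Fin n → F) := Q.polarBilin with hB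
  have d0 := finrank_perp hQ W
  have d1 := finrank_perp_sup_span_ge hQ W v
  rw [Module.finrank_fin_fun] at d0
  -- a nonsingular `c` orthogonal to `W` and `v`, outside `W`
  obtain ⟨c, hcW, hcv, hQc, hcW'⟩ : ∃ c, c ∈ perp B W ∧ B v c = 0 ∧ Q c ≠ 0 ∧ c ∉ W := by
    obtain ⟨W', hW'⟩ := Submodule.exists_isCompl W
    have e1 := Submodule.finrank_add_eq_of_isCompl hW'
    have e2 := Submodule.finrank_sup_add_finrank_inf_eq (perp B (W ⊔ F ∙ v)) W'
    have e3 := Submodule.finrank_le (perp B (W ⊔ F ∙ v) ⊔ W')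
    rw [Module.finrank_fin_fun] at e1 e3
    obtain ⟨c, ⟨hc, hcW'⟩, hQc⟩ :=
      exists_quadraticForm_ne_zero hQ (perp B (W ⊔ F ∙ v) ⊓ W') (by omega)
    obtain ⟨h1, h2⟩ := mem_perp_sup_span.1 hc
    refine ⟨c, h1, h2, hQc, fun h => hQc ?_⟩
    rw [Submodule.disjoint_def.1 hW'.disjoint c h hcW', QuadraticMap.map_zero]
  -- `a₁` in the complement of `W`, orthogonal neither to `v` nor to `c`
  obtain ⟨a₁, ha₁, hva₁, hca₁⟩ : ∃ a ∈ perp B W, B v a ≠ 0 ∧ B c a ≠ 0 := by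
    obtain ⟨a, ha, hva⟩ := exists_mem_perp_ne_zero hQ hv
    obtain ⟨b, hb, hcb⟩ := exists_mem_perp_ne_zero hQ hcW'
    by_cases h1 : B c a = 0
    · by_cases h2 : B v b = 0
      · refine ⟨a + b, add_mem ha hb, ?_, ?_⟩
        · rwa [map_add, h2, add_zero]
        · rwa [map_add, h1, zero_add]
      · exact ⟨b, hb, h2, hcb⟩
    · exact ⟨a, ha, hva, h1⟩
  -- such a vector that is moreover nonsingular
  obtain ⟨a₀, ha₀, hva₀, hca₀, hQa₀⟩ :
      ∃ a ∈ perp B W, B v a ≠ 0 ∧ B c a ≠ 0 ∧ Q a ≠ 0 := by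
    by_cases h : Q a₁ = 0
    · have d2 := finrank_perp_sup_span_ge hQ (W ⊔ F ∙ v) c
      have d3 := finrank_perp_sup_span_ge hQ (W ⊔ F ∙ v ⊔ F ∙ c) a₁
      obtain ⟨u, hu, hQu⟩ :=
        exists_quadraticForm_ne_zero hQ (perp B (W ⊔ F ∙ v ⊔ F ∙ c ⊔ F ∙ a₁)) (by omega)
      obtain ⟨hu, hua⟩ := mem_perp_sup_span.1 hu
      obtain ⟨hu, huc⟩ := mem_perp_sup_span.1 hu
      obtain ⟨hu, huv⟩ := mem_perp_sup_span.1 hu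
      refine ⟨a₁ + u, add_mem ha₁ hu, ?_, ?_, ?_⟩
      · rwa [map_add, huv, add_zero]
      · rwa [map_add, huc, add_zero]
      · rwa [quadraticForm_add, h, hua, add_zero, zero_add]
    · exact ⟨a₁, ha₁, hva₁, hca₁, h⟩
  set W₃ := W ⊔ F ∙ v ⊔ F ∙ c ⊔ F ∙ a₀ with hW₃
  have d4 : finrank F W₃ ≤ finrank F W + 3 := by
    have d2 := finrank_perp_sup_span_ge hQ (W ⊔ F ∙ v) c
    have d3 : _ ≤ finrank F (perp B W₃) + 1 :=
      finrank_perp_sup_span_ge hQ (W ⊔ F ∙ v ⊔ F ∙ c) a₀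
    have : finrank F W₃ + finrank F (perp B W₃) = _ := finrank_perp hQ W₃
    rw [Module.finrank_fin_fun] at this
    omega
  have hcount := card_quadraticForm_ne hQ W₃ hQa₀ (m := n - finrank F W - 5) (by omega)
  have hcard := card_le_card_mul_sq {u | u ∈ perp B W₃ ∧ Q u ≠ -Q a₀}
    (stabOrbit ⁅orthogonalGroup Q ⊓ specialSubgroup F n,
        orthogonalGroup Q ⊓ specialSubgroup F n⁆ W v) a₀ v c (by
      rintro u ⟨hu, hQu⟩
      obtain ⟨hu, hua⟩ := mem_perp_sup_span.1 hu
      obtain ⟨hu, huc⟩ := mem_perp_sup_span.1 hu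
      obtain ⟨hu, huv⟩ := mem_perp_sup_span.1 hu
      have ha : a₀ + u ∈ perp B W := add_mem ha₀ hu
      have hva : B v (a₀ + u) ≠ 0 := by rwa [map_add, huv, add_zero]
      have hca : B c (a₀ + u) ≠ 0 := by rwa [map_add, huc, add_zero]
      have hQa : Q (a₀ + u) ≠ 0 := by
        rw [quadraticForm_add, hua, add_zero]
        intro h
        exact hQu (by linear_combination h)
      -- `y = (r_a r_c) ^ 2 v` differs from `v` by a combination of `a` and `c`, and the
      -- coefficient of `a` does not vanish because `a` is orthogonal neither to `v` nor to `c`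
      generalize a₀ + u = a at ha hva hca hQa
      have hav : B a v ≠ 0 := by rwa [hB, polarBilin_comm]
      have hac : B a c ≠ 0 := by rwa [hB, polarBilin_comm]
      have hcv' : B c v = 0 := by rw [hB, polarBilin_comm, hcv]
      have hca' : B c a = B a c := polarBilin_comm Q c a
      have haa : B a a = 2 * Q a := polarBilin_self Q a
      set g := quadraticReflection hQa * quadraticReflection hQc * quadraticReflection hQa *
        quadraticReflection hQc with hg
      have hgx : ∀ x, g.1 *ᵥ x = (quadraticReflection hQa).1 *ᵥ ((quadraticReflection hQc).1 *ᵥ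
          ((quadraticReflection hQa).1 *ᵥ ((quadraticReflection hQc).1 *ᵥ x))) := by
        intro x
        simp only [hg, Units.val_mul, mulVec_mulVec, mul_assoc]
      refine ⟨g.1 *ᵥ v, ⟨g, mul_reflections_mem_omega hQ (by omega) hQa hQc, ?_, rfl⟩,
        -(Q a * Q a * Q c / (B a v * B a c * B a c)), Q a / B a c, ?_⟩
      · intro w hw
        have e1 : B a w = 0 := by rw [hB, polarBilin_comm]; exact mem_perp.1 ha w hw
        have e2 : B c w = 0 := by rw [hB, polarBilin_comm]; exact mem_perp.1 hcW w hw
        simp only [hgx, quadraticReflection_mulVec, ← hB, e1, e2, zero_div, zero_smul, sub_zero]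
      · simp only [hgx, quadraticReflection_mulVec, ← hB, map_sub, map_smul, hcv', hca', haa,
          zero_div, zero_smul, sub_zero, smul_eq_mul]
        ext i
        simp only [Pi.add_apply, Pi.sub_apply, Pi.smul_apply, smul_eq_mul]
        field_simp
        ring)
  exact pow_le_card_of_pow_le_mul_sq (hcount.trans hcard) (by omega)

end Orthogonal

/-! ### Vectors with small cyclic subspace -/

section Support

open Module Polynomial IntermediateField

variable {F : Type*} [Field F] {n : ℕ}

/-- The rank of a matrix does not change under an extension of the field. -/
lemma rank_map_ringHom {E K : Type*} [Field E] [Field K] (φ : E →+* K)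
    (A : Matrix (Fin n) (Fin n) E) : (A.map φ).rank = A.rank := by
  classical
  obtain ⟨L, L', D, hA⟩ := Matrix.Pivot.exists_list_transvec_mul_diagonal_mul_list_transvec A
  set V := (L.map TransvectionStruct.toMatrix).prod with hV
  set U := (L'.map TransvectionStruct.toMatrix).prod with hU
  have hVd : V.det = 1 := TransvectionStruct.det_toMatrix_prod L
  have hUd : U.det = 1 := TransvectionStruct.det_toMatrix_prod L'
  have hdet : ∀ B : Matrix (Fin n) (Fin n) E, B.det = 1 → IsUnit (B.map φ).det := by
    intro B hB
    rw [← RingHom.mapMatrix_apply, ← RingHom.map_det, hB, map_one]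
    exact isUnit_one
  rw [hA, Matrix.map_mul, Matrix.map_mul, rank_mul_eq_left_of_isUnit_det _ _ (hdet U hUd),
    rank_mul_eq_right_of_isUnit_det _ _ (hdet V hVd),
    rank_mul_eq_left_of_isUnit_det _ _ (by rw [hUd]; exact isUnit_one),
    rank_mul_eq_right_of_isUnit_det _ _ (by rw [hVd]; exact isUnit_one),
    diagonal_map (map_zero φ), rank_diagonal, rank_diagonal]
  simp

/-- The vectors `v` whose cyclic subspace under `g` is spanned by `v, g v, …, g ^ (d - 1) v`. -/
def cyclicVectors (g : GL (Fin n) F) (d : ℕ) : Set (Fin n → F) :=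
  {v | (g ^ d).1 *ᵥ v ∈ Submodule.span F {y | ∃ i < d, y = (g ^ i).1 *ᵥ v}}

lemma exists_rank_eq_supp (g : GL (Fin n) F) : ∃ a : AlgebraicClosure F,
    (g.1.map (algebraMap F (AlgebraicClosure F)) - Matrix.scalar (Fin n) a).rank = supp g :=
  Nat.sInf_mem (Set.range_nonempty _)

variable [Finite F]

/-- If `a` generates an extension `E` of degree `d` of `F`, then the `a`-eigenspace of `g` on
`E ^ n` embeds into the kernel of `p(g)` on `F ^ n`, where `p` is the minimal polynomial of `a`:
apply a nonzero functional `E → F` to each coordinate. -/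
lemma pow_le_card_cyclicVectors (g : GL (Fin n) F) :
    ∃ d, 0 < d ∧ Nat.card F ^ (d * (n - supp g)) ≤ Nat.card (cyclicVectors g d) := by
  obtain ⟨a, ha⟩ := exists_rank_eq_supp g
  have hint : IsIntegral F a := Algebra.IsIntegral.isIntegral a
  set pb := adjoin.powerBasis hint with hpb
  set b : F⟮a⟯ := pb.gen with hb
  have hba : algebraMap F⟮a⟯ (AlgebraicClosure F) b = a := by
    rw [hb, hpb, adjoin.powerBasis_gen]; exact AdjoinSimple.algebraMap_gen F a
  have : Module.Finite F F⟮a⟯ := adjoin.finiteDimensional hint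
  have : Finite F⟮a⟯ := Module.finite_of_finite F
  set d := finrank F F⟮a⟯ with hd
  have hd0 : 0 < d := finrank_pos
  have hdeg : (minpoly F b).natDegree = d := by
    rw [hd, pb.finrank, pb.natDegree_minpoly]
  have hbint : IsIntegral F b := Algebra.IsIntegral.isIntegral b
  set A : Matrix (Fin n) (Fin n) F⟮a⟯ := g.1.map (algebraMap F F⟮a⟯) - Matrix.scalar (Fin n) b
    with hA
  have hrank : A.rank = supp g := by
    rw [← ha, ← rank_map_ringHom (algebraMap F⟮a⟯ (AlgebraicClosure F)) A]
    congr 1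
    ext i j
    rw [hA, Matrix.map_apply, Matrix.sub_apply, map_sub, Matrix.sub_apply, Matrix.map_apply,
      Matrix.map_apply, ← IsScalarTower.algebraMap_apply]
    congr 1
    by_cases hij : i = j
    · subst hij; simp [hba]
    · simp [Matrix.scalar_apply, Matrix.diagonal_apply_ne _ hij]
  set U := A.mulVecLin.ker with hU
  have hUdim : finrank F⟮a⟯ U = n - supp g := by
    have h1 : _ + finrank F⟮a⟯ U = _ := LinearMap.finrank_range_add_finrank_ker A.mulVecLin
    rw [Module.finrank_fin_fun] at h1
    have h2 : finrank F⟮a⟯ A.mulVecLin.range = supp g := hrank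
    omega
  have hUcard : Nat.card U = Nat.card F ^ (d * (n - supp g)) := by
    rw [natCard_eq_pow_finrank (K := F⟮a⟯) (V := U), natCard_eq_pow_finrank (K := F) (V := F⟮a⟯),
      ← pow_mul, hUdim]
  refine ⟨d, hd0, ?_⟩
  obtain ⟨t, ht1, -⟩ := Submodule.exists_le_ker_of_notMem (K := F)
    (p := (⊥ : Submodule F F⟮a⟯)) (v := 1) (by simp)
  -- `g` acts on coordinatewise images of eigenvectors as multiplication by the eigenvalue does
  have hgu : ∀ u ∈ U, ∀ j, ∑ k, algebraMap F F⟮a⟯ (g.1 j k) * u k = b * u j := by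
    intro u hu j
    have h1 : A *ᵥ u = 0 := hu
    have h2 := congrFun h1 j
    rw [hA, Matrix.sub_mulVec, Pi.sub_apply, Pi.zero_apply, sub_eq_zero] at h2
    simpa [Matrix.mulVec, dotProduct, Matrix.scalar_apply, Matrix.diagonal_apply] using h2
  have hgt : ∀ u ∈ U, ∀ i : ℕ, (g ^ i).1 *ᵥ (fun j => t (u j)) = fun j => t (b ^ i * u j) := by
    intro u hu i
    induction i with
    | zero => simp
    | succ i ih =>
      rw [pow_succ', Units.val_mul, ← mulVec_mulVec, ih]
      funext j
      simp only [Matrix.mulVec, dotProduct]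
      calc ∑ k, g.1 j k * t (b ^ i * u k)
          = t (∑ k, g.1 j k • (b ^ i * u k)) := by
            rw [map_sum]; exact Finset.sum_congr rfl fun k _ => by rw [map_smul, smul_eq_mul]
        _ = t (b ^ i * ∑ k, algebraMap F F⟮a⟯ (g.1 j k) * u k) := by
            congr 1
            rw [Finset.mul_sum]
            exact Finset.sum_congr rfl fun k _ => by rw [Algebra.smul_def]; ring
        _ = t (b ^ (i + 1) * u j) := by rw [hgu u hu j]; congr 1; ring
  have hmem : ∀ u ∈ U, (fun j => t (u j)) ∈ cyclicVectors g d := by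
    intro u hu
    have h0 := minpoly.aeval F b
    rw [aeval_eq_sum_range, Finset.sum_range_succ, hdeg] at h0
    have hlead : (minpoly F b).coeff d = 1 := by
      have := minpoly.monic hbint
      rw [Monic, leadingCoeff, hdeg] at this
      exact this
    rw [hlead, one_smul] at h0
    have h1 : b ^ d = - ∑ i ∈ Finset.range d, (minpoly F b).coeff i • b ^ i :=
      eq_neg_of_add_eq_zero_right h0
    have h2 : (g ^ d).1 *ᵥ (fun j => t (u j)) =
        - ∑ i ∈ Finset.range d, (minpoly F b).coeff i • ((g ^ i).1 *ᵥ fun j => t (u j)) := by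
      rw [hgt u hu d]
      simp only [hgt u hu]
      funext j
      rw [h1, Pi.neg_apply, Finset.sum_apply, neg_mul, map_neg, Finset.sum_mul, map_sum]
      congr 1
      exact Finset.sum_congr rfl fun i _ => by
        rw [smul_mul_assoc, map_smul, Pi.smul_apply]
    change _ ∈ Submodule.span F _
    rw [h2]
    refine neg_mem (sum_mem fun i hi => Submodule.smul_mem _ _ (Submodule.subset_span ?_))
    exact ⟨i, Finset.mem_range.1 hi, rfl⟩
  have hinj : Function.Injective
      fun u : U => (⟨fun j => t (u.1 j), hmem u.1 u.2⟩ : cyclicVectors g d) := by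
    rintro ⟨u, hu⟩ ⟨u', hu'⟩ heq
    have heq : (fun j => t (u j)) = fun j => t (u' j) := congrArg Subtype.val heq
    have h1 : ∀ (i : ℕ) j, t (b ^ i * (u j - u' j)) = 0 := by
      intro i j
      have h2 := hgt u hu i
      rw [heq, hgt u' hu' i] at h2
      rw [mul_sub, map_sub, sub_eq_zero]
      exact (congrFun h2 j).symm
    refine Subtype.ext (funext fun j => ?_)
    by_contra hne
    obtain ⟨f, hf⟩ := pb.exists_eq_aeval' (u j - u' j)⁻¹
    apply ht1
    rw [← inv_mul_cancel₀ (sub_ne_zero.2 hne), hf, aeval_eq_sum_range, Finset.sum_mul, map_sum]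
    exact Finset.sum_eq_zero fun i _ => by
      rw [smul_mul_assoc, map_smul, ← hb, h1, smul_zero]
  rw [← hUcard]
  exact Nat.card_le_card_of_injective _ hinj

lemma mul_sub_supp_le {g : GL (Fin n) F} {d : ℕ}
    (h : Nat.card F ^ (d * (n - supp g)) ≤ Nat.card (cyclicVectors g d)) :
    d * (n - supp g) ≤ n := by
  have h1 : Nat.card (cyclicVectors g d) ≤ Nat.card (Fin n → F) :=
    Nat.card_le_card_of_injective _ Subtype.val_injective
  rw [Nat.card_fun, Nat.card_fin] at h1
  exact (Nat.pow_le_pow_iff_right Finite.one_lt_card).1 (h.trans h1)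

omit [Finite F] in
/-- The support is a class function. -/
lemma supp_conj (g h : GL (Fin n) F) : supp (h * g * h⁻¹) = supp g := by
  unfold supp
  congr 1
  funext a
  set φ := algebraMap F (AlgebraicClosure F)
  have h1 : h.1.map φ * h⁻¹.1.map φ = 1 := by
    rw [← Matrix.map_mul, Units.mul_inv, Matrix.map_one _ (map_zero φ) (map_one φ)]
  have h2 : (h * g * h⁻¹).1.map φ - Matrix.scalar (Fin n) a =
      h.1.map φ * (g.1.map φ - Matrix.scalar (Fin n) a) * h⁻¹.1.map φ := by
    rw [mul_sub, sub_mul, Units.val_mul, Units.val_mul, Matrix.map_mul, Matrix.map_mul,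
      ← (Matrix.scalar_commute a (fun r => mul_comm a r) (h.1.map φ)).eq, mul_assoc (scalar _ a),
      h1, mul_one]
  have hu : IsUnit (h.1.map φ).det := (isUnit_iff_isUnit_det _).1 (IsUnit.of_mul_eq_one _ h1)
  have hu' : IsUnit (h⁻¹.1.map φ).det :=
    (isUnit_iff_isUnit_det _).1 (IsUnit.of_mul_eq_one _ (mul_eq_one_comm.1 h1))
  rw [h2, rank_mul_eq_left_of_isUnit_det _ _ hu', rank_mul_eq_right_of_isUnit_det _ _ hu]

end Support

/-! ### The moment method for classical groups -/

section Counting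

open Module Finset
open scoped Classical

variable {F : Type*} [Field F] [Finite F] {n : ℕ}

lemma stabOrbit_mono {G H : Subgroup (GL (Fin n) F)} (h : G ≤ H) (W : Submodule F (Fin n → F))
    (v : Fin n → F) : Nat.card (stabOrbit G W v) ≤ Nat.card (stabOrbit H W v) :=
  Nat.card_mono (Set.toFinite _) fun _ ⟨g, hg, hgv⟩ => ⟨g, h hg, hgv⟩

/-- In a classical group, the pointwise stabilizer of a subspace of small dimension has almost
maximally large orbits on the vectors outside that subspace. -/
lemma IsClassical.pow_le_card_stabOrbit {G : Subgroup (GL (Fin n) F)} (hG : IsClassical G)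
    (hn : 21 ≤ n) (W : Submodule F (Fin n → F)) (hW : 10 * finrank F W ≤ n) {v : Fin n → F}
    (hv : v ∉ W) : Nat.card F ^ (n - finrank F W - 7) ≤ Nat.card (stabOrbit G W v) := by
  obtain ⟨φ, hφ, -⟩ := hG
  refine le_trans ?_ (stabOrbit_mono hφ W v)
  have hpow : ∀ {a b : ℕ}, a ≤ b → Nat.card F ^ a ≤ Nat.card F ^ b :=
    fun h => Nat.pow_le_pow_right Nat.card_pos h
  cases φ with
  | linear => exact (hpow (by omega)).trans (stabOrbit_special W v hv (by omega))
  | symplectic f alt nondeg =>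
    exact (hpow (by omega)).trans (stabOrbit_symplectic alt nondeg W v hv (by omega))
  | orthogonal Q nondeg => exact stabOrbit_omega nondeg W v hv hn hW
  | unitary θ ne inv f herm nondeg =>
    exact (hpow (by omega)).trans (stabOrbit_unitary ne inv herm nondeg W v hv (by omega))

/-- The natural representation of a matrix group. -/
noncomputable def naturalRep (G : Subgroup (GL (Fin n) F)) : Representation F G (Fin n → F) :=
  (Matrix.toLinAlgEquiv' : Matrix (Fin n) (Fin n) F ≃ₐ[F] _).toAlgHom.toMonoidHom.comp
    ((Units.coeHom _).comp G.subtype)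

omit [Finite F] in
lemma naturalRep_apply (G : Subgroup (GL (Fin n) F)) (g : G) (v : Fin n → F) :
    naturalRep G g v = g.1.1 *ᵥ v := by
  rfl

lemma IsClassical.orbitBound [Fintype F] {G : Subgroup (GL (Fin n) F)} [Fintype G]
    (hG : IsClassical G) (hn : 21 ≤ n) {M : ℕ} (hM : 10 * M ≤ n) :
    OrbitBound (naturalRep G) M (Nat.card F ^ (n - M - 7)) := by
  intro W hW v hv
  have h1 := hG.pow_le_card_stabOrbit hn W (by omega) hv
  refine ((Nat.pow_le_pow_right Nat.card_pos (by omega)).trans h1).trans (le_of_eq ?_)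
  rw [← Fintype.card_subtype, ← Nat.card_eq_fintype_card]
  refine Nat.card_congr (Equiv.subtypeEquivRight fun y => ?_)
  constructor
  · rintro ⟨g, hg, h⟩
    exact ⟨⟨g, hg⟩, h⟩
  · rintro ⟨g, h⟩
    exact ⟨g.1, g.2, h⟩

lemma evalWord_mk {G : Type*} [Group G] {k : ℕ} (c : List (Fin k × Bool)) (x : Fin k → G) :
    evalWord (FreeGroup.mk c) x = (c.map (letterVal x)).prod :=
  FreeGroup.lift_mk

lemma prod_map_flatten_replicate {G : Type*} [Group G] {k : ℕ} (c : List (Fin k × Bool))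
    (x : Fin k → G) (i : ℕ) :
    ((List.replicate i c).flatten.map (letterVal x)).prod = evalWord (FreeGroup.mk c) x ^ i := by
  rw [evalWord_mk]
  induction i with
  | zero => simp
  | succ i ih => rw [List.replicate_succ, List.flatten_cons, List.map_append, List.prod_append, ih,
      pow_succ']

omit [Finite F] in
/-- A cyclic subspace of dimension at most `d` forces a coincidence in the walk along the `d`-th
power of the word. Words act on the left, so the walk reads them backwards. -/
lemma coincidence_of_mem_cyclicVectors {G : Subgroup (GL (Fin n) F)} {k : ℕ}
    {c : List (Fin k × Bool)} (hc : c ≠ []) {d : ℕ} (hd : 0 < d) (x : Fin k → G) {v : Fin n → F}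
    {U : Submodule F (Fin n → F)} (hv : v ∉ U)
    (h : v ∈ cyclicVectors (evalWord (FreeGroup.mk c) x).1 d) :
    Coincidence (naturalRep G) x U v (List.replicate d c).flatten.reverse := by
  by_contra hcon
  refine notMem_of_not_coincidence x _ U v hv hcon ?_ ?_
  · simp [hc, hd.ne']
  · rw [List.map_reverse, List.reverse_reverse, prod_map_flatten_replicate, naturalRep_apply]
    refine Submodule.mem_sup_right (Submodule.span_mono ?_ h)
    rintro y ⟨i, hi, rfl⟩
    refine ⟨(List.replicate i c).flatten.reverse, (List.replicate (d - i) c).flatten.reverse,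
      ?_, ?_, ?_⟩
    · rw [← List.reverse_append, ← List.flatten_append, List.replicate_append_replicate,
        Nat.sub_add_cancel hi.le]
    · have : d - i ≠ 0 := by omega
      simp [hc, this]
    · rw [List.map_reverse, List.reverse_reverse, prod_map_flatten_replicate, naturalRep_apply]
      rfl

lemma isReduced_reverse {α : Type*} {l : List (α × Bool)} (h : FreeGroup.IsReduced l) :
    FreeGroup.IsReduced l.reverse := by
  unfold FreeGroup.IsReduced at h ⊢
  rw [List.isChain_reverse]
  exact h.imp fun a b hab e => (hab e.symm).symm

/-- Markov's inequality for the `r`-th moment of the number of vectors with small cyclic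
subspace. -/
lemma card_le_card_cyclicVectors_mul_le {G : Subgroup (GL (Fin n) F)} (hG : IsClassical G)
    (hn : 21 ≤ n) {k : ℕ} {c : List (Fin k × Bool)} (hc : FreeGroup.IsCyclicallyReduced c)
    (hc0 : c ≠ []) {d : ℕ} (hd : 0 < d) {r M : ℕ} (hr : r * (d * c.length + 1) ≤ M)
    (hM : 10 * M ≤ n) (T : ℕ) :
    Nat.card {x : Fin k → G //
        T ≤ Nat.card (cyclicVectors (evalWord (FreeGroup.mk c) x).1 d)} *
      (T * Nat.card F ^ (n - M - 7)) ^ r ≤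
    (Nat.card F ^ M * Nat.card F ^ (n - M - 7) +
      Nat.card F ^ n * (d * c.length * Nat.card F ^ M)) ^ r * Nat.card (Fin k → G) := by
  have : Fintype F := Fintype.ofFinite F
  have : Fintype G := Fintype.ofFinite G
  set l := (List.replicate d c).flatten.reverse with hl
  have hlen : l.length = d * c.length := by simp [hl]
  have hred : FreeGroup.IsReduced l := isReduced_reverse (hc.flatten_replicate d).isReduced
  have hmom := sum_pow_card_mul_le (hG.orbitBound hn hM) hred
    (fun x v => v ∈ cyclicVectors (evalWord (FreeGroup.mk c) x).1 d)
    (fun x v U hv h => coincidence_of_mem_cyclicVectors hc0 hd x hv h) r univ (fun _ => ⊥) ⊥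
    isPrescribed_univ (fun _ => le_rfl) (by rw [finrank_bot, hlen]; omega)
  have hV : Fintype.card (Fin n → F) = Nat.card F ^ n := by
    rw [Fintype.card_fun, Fintype.card_fin, Nat.card_eq_fintype_card]
  rw [hlen, hV, ← Nat.card_eq_fintype_card, card_univ, ← Nat.card_eq_fintype_card] at hmom
  refine le_trans ?_ hmom
  rw [mul_pow, ← mul_assoc]
  refine Nat.mul_le_mul_right _ ?_
  have hcyc : ∀ x : Fin k → G, Nat.card (cyclicVectors (evalWord (FreeGroup.mk c) x).1 d) =
      #{v | v ∈ cyclicVectors (evalWord (FreeGroup.mk c) x).1 d} := by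
    intro x
    rw [Nat.card_eq_fintype_card, Fintype.card_subtype]
  rw [Nat.card_eq_fintype_card, Fintype.card_subtype, ← smul_eq_mul]
  refine (card_nsmul_le_sum _ (fun x : Fin k → G =>
    #{v | v ∈ cyclicVectors (evalWord (FreeGroup.mk c) x).1 d} ^ r) _ ?_).trans
    (sum_le_sum_of_subset (subset_univ _))
  intro x hx
  rw [← hcyc]
  exact Nat.pow_le_pow_left (mem_filter.1 hx).2 r

/-- For words that are short compared with `κ`, there are `q ^ (d κ)` vectors with cyclic subspace
of dimension at most `d` only with probability `q ^ (-s)`, where `s ≥ κ ^ 2 / (160 ℓ)`. The moment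
is chosen so large that the dimensions of the prescribed subspaces just stay below `d κ / 10`. -/
lemma exists_card_mul_pow_le {G : Subgroup (GL (Fin n) F)} (hG : IsClassical G) {k : ℕ}
    {c : List (Fin k × Bool)} (hc : FreeGroup.IsCyclicallyReduced c) (hc0 : c ≠ []) {d κ : ℕ}
    (hd : 0 < d) (hκ : 20 * (d * c.length) < κ) (hκn : d * κ ≤ n) :
    ∃ s : ℕ, κ ^ 2 ≤ 160 * c.length * s ∧
      Nat.card {x : Fin k → G // Nat.card F ^ (d * κ) ≤
        Nat.card (cyclicVectors (evalWord (FreeGroup.mk c) x).1 d)} * Nat.card F ^ s ≤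
      Nat.card (Fin k → G) := by
  set ℓ := c.length with hℓ
  have hℓ0 : 0 < ℓ := List.length_pos_iff.2 hc0
  have hdℓ : 0 < d * ℓ := Nat.mul_pos hd hℓ0
  have hκd : κ ≤ d * κ := Nat.le_mul_of_pos_left κ hd
  set r := d * κ / (10 * (d * ℓ + 1)) with hr
  set M := r * (d * ℓ + 1) with hM
  have hM10 : 10 * M ≤ d * κ := by
    have := Nat.div_mul_le_self (d * κ) (10 * (d * ℓ + 1))
    rw [← hr] at this
    calc 10 * M = r * (10 * (d * ℓ + 1)) := by rw [hM]; ring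
      _ ≤ _ := this
  have hr1 : 1 ≤ r := (Nat.one_le_div_iff (by positivity)).2 (by omega)
  have hrκ : κ ≤ 40 * ℓ * r := by
    have h1 : d * κ < 10 * (d * ℓ + 1) * (r + 1) := by
      have := Nat.lt_mul_div_succ (d * κ) (b := 10 * (d * ℓ + 1)) (by positivity)
      exact this
    have h2 : 10 * (d * ℓ + 1) * (r + 1) ≤ 10 * (2 * (d * ℓ)) * (2 * r) := by
      gcongr <;> omega
    refine Nat.le_of_mul_le_mul_left (c := d) ?_ hd
    calc d * κ ≤ 10 * (2 * (d * ℓ)) * (2 * r) := by omega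
      _ = d * (40 * ℓ * r) := by ring
  set q := Nat.card F with hq
  have hq2 : 2 ≤ q := Finite.one_lt_card
  -- the truncated subtraction is harmless, since `20 < κ` leaves room for the `7`
  set t := d * κ - 2 * M - 7 - d * ℓ with ht
  have ht4 : d * κ ≤ 4 * t := by omega
  refine ⟨t * r, ?_, ?_⟩
  · calc κ ^ 2 = κ * κ := sq κ
      _ ≤ (40 * ℓ * r) * (4 * t) := Nat.mul_le_mul hrκ (hκd.trans ht4)
      _ = 160 * ℓ * (t * r) := by ring
  · have hmain := card_le_card_cyclicVectors_mul_le hG (by omega) hc hc0 hd (r := r) (M := M)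
      le_rfl (by omega) (q ^ (d * κ))
    rw [← hℓ, ← hq] at hmain
    have hbase : q ^ M * q ^ (n - M - 7) + q ^ n * (d * ℓ * q ^ M) ≤ q ^ (n + M + d * ℓ) := by
      have h1 : q ^ M * q ^ (n - M - 7) ≤ q ^ M * q ^ n :=
        Nat.mul_le_mul_left _ (Nat.pow_le_pow_right (by omega) (by omega))
      have h2 : d * ℓ + 1 ≤ q ^ (d * ℓ) :=
        Nat.succ_le_of_lt (Nat.lt_pow_self (by omega))
      calc _ ≤ q ^ M * q ^ n + q ^ n * (d * ℓ * q ^ M) := Nat.add_le_add_right h1 _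
        _ = q ^ n * q ^ M * (d * ℓ + 1) := by ring
        _ ≤ q ^ n * q ^ M * q ^ (d * ℓ) := Nat.mul_le_mul_left _ h2
        _ = _ := by rw [pow_add, pow_add]
    have hexp : q ^ (d * κ) * q ^ (n - M - 7) = q ^ t * q ^ (n + M + d * ℓ) := by
      rw [← pow_add, ← pow_add]
      congr 1
      omega
    rw [hexp, mul_pow, ← mul_assoc, ← pow_mul] at hmain
    have h3 := hmain.trans (Nat.mul_le_mul_right _ (Nat.pow_le_pow_left hbase r))
    rw [mul_comm ((q ^ (n + M + d * ℓ)) ^ r)] at h3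
    exact Nat.le_of_mul_le_mul_right h3 (by positivity)

/-- Every nontrivial word is conjugate to a nontrivial cyclically reduced word that is not
longer. -/
lemma exists_isCyclicallyReduced {k : ℕ} {w : FreeGroup (Fin k)} (hw : w ≠ 1) :
    ∃ c : List (Fin k × Bool), FreeGroup.IsCyclicallyReduced c ∧ c ≠ [] ∧ c.length ≤ w.norm ∧
      ∃ u, w = u * FreeGroup.mk c * u⁻¹ := by
  set c := FreeGroup.reduceCyclically w.toWord with hc
  have hconj := FreeGroup.reduceCyclically.conj_conjugator_reduceCyclically w.toWord
  rw [← hc] at hconj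
  have hwc : w = FreeGroup.mk (FreeGroup.reduceCyclically.conjugator w.toWord) *
      FreeGroup.mk c * (FreeGroup.mk (FreeGroup.reduceCyclically.conjugator w.toWord))⁻¹ := by
    rw [FreeGroup.inv_mk, FreeGroup.mul_mk, FreeGroup.mul_mk, hconj, FreeGroup.mk_toWord]
  refine ⟨c, FreeGroup.reduceCyclically.isCyclicallyReduced FreeGroup.isReduced_toWord, ?_, ?_,
    _, hwc⟩
  · intro h
    apply hw
    rw [hwc, h, ← FreeGroup.one_eq_mk, mul_one, mul_inv_cancel]
  · have := congrArg List.length hconj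
    simp only [List.length_append] at this
    rw [FreeGroup.norm]
    omega

omit [Finite F] in
lemma supp_evalWord_conj {G : Subgroup (GL (Fin n) F)} {k : ℕ} (u c : FreeGroup (Fin k))
    (x : Fin k → G) : supp (evalWord (u * c * u⁻¹) x).1 = supp (evalWord c x).1 := by
  have : (evalWord (u * c * u⁻¹) x).1 =
      (evalWord u x).1 * (evalWord c x).1 * (evalWord u x).1⁻¹ := by
    simp [evalWord]
  rw [this, supp_conj]

lemma card_subgroup_le (G : Subgroup (GL (Fin n) F)) : Nat.card G ≤ Nat.card F ^ (n ^ 2) := by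
  have h1 : Function.Injective fun g : G => (g.1.1 : Matrix (Fin n) (Fin n) F) :=
    fun a b h => Subtype.ext (Units.ext h)
  have h2 := Nat.card_le_card_of_injective _ h1
  have h3 : Nat.card (Matrix (Fin n) (Fin n) F) = Nat.card F ^ (n ^ 2) := by
    change Nat.card (Fin n → Fin n → F) = _
    rw [Nat.card_fun, Nat.card_fun, Nat.card_fin, ← pow_mul, sq]
  rwa [h3] at h2

/-- The union bound over the degree `d` of the field generated by the eigenvalue. -/
lemma card_supp_le {G : Subgroup (GL (Fin n) F)} {k : ℕ} (c : List (Fin k × Bool)) {κ : ℕ}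
    (hκ : 0 < κ) :
    Nat.card {x : Fin k → G // supp (evalWord (FreeGroup.mk c) x).1 + κ ≤ n} ≤
      ∑ d ∈ Icc 1 (n / κ), Nat.card {x : Fin k → G //
        Nat.card F ^ (d * κ) ≤ Nat.card (cyclicVectors (evalWord (FreeGroup.mk c) x).1 d)} := by
  have : Fintype G := Fintype.ofFinite G
  simp only [Nat.card_eq_fintype_card (α := {x : Fin k → G // _}), Fintype.card_subtype]
  refine le_trans (card_le_card ?_) card_biUnion_le
  intro x hx
  have hx := (mem_filter.1 hx).2
  obtain ⟨d, hd, h⟩ := pow_le_card_cyclicVectors (evalWord (FreeGroup.mk c) x).1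
  have h1 : d * κ ≤ d * (n - supp (evalWord (FreeGroup.mk c) x).1) :=
    Nat.mul_le_mul_left _ (by omega)
  have h2 := h1.trans (mul_sub_supp_le h)
  exact mem_biUnion.2 ⟨d, mem_Icc.2 ⟨hd, (Nat.le_div_iff_mul_le hκ).2 h2⟩, mem_filter.2
    ⟨mem_univ _, (Nat.pow_le_pow_right Nat.card_pos h1).trans h⟩⟩

end Counting

end ClassicalGroup


open ClassicalGroup in
theorem theorem4p2 :
    ∃ c > (0 : ℝ), ∃ C > (0 : ℝ), ∀ δ > (0 : ℝ),
      ∀ (F : Type*) [Field F] [Finite F] (n : ℕ) (G : Subgroup (GL (Fin n) F)),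
        ClassicalGroup.IsClassical G →
        ∀ (k : ℕ) (w : FreeGroup (Fin k)), w ≠ 1 →
          (w.norm : ℝ) < δ ^ 2 * n / 20 →
          C < (Nat.card F : ℝ) ^ (δ * n) →
          ClassicalGroup.uniformProb (fun x : Fin k → G =>
              (ClassicalGroup.supp (ClassicalGroup.evalWord w x).1 : ℝ)
                ≤ (1 - δ) * n)
            ≤ (Nat.card G : ℝ) ^ (-(c * δ ^ 2 / w.norm)) := by
  -- `C` is not needed: as `1 ≤ ℓ`, the bound on `ℓ` already forces `20 < δ ^ 2 * n`
  refine ⟨1 / 320, by norm_num, 1, one_pos, ?_⟩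
  intro δ hδ F _ _ n G hG k w hw hℓ _
  set ℓ : ℝ := (w.norm : ℝ) with hℓdef
  have hℓ1 : 1 ≤ ℓ := by
    rw [hℓdef, Nat.one_le_cast, Nat.one_le_iff_ne_zero]
    exact fun h => hw (FreeGroup.norm_eq_zero.1 h)
  have hn : (0 : ℝ) < n := by
    by_contra! h
    nlinarith [sq_nonneg δ]
  set q : ℝ := (Nat.card F : ℝ) with hq
  have hq2 : 2 ≤ q := by
    rw [hq]
    exact_mod_cast (Finite.one_lt_card : 1 < Nat.card F)
  have hq0 : 0 < q := by linarith
  rcases lt_or_ge 1 δ with hδ1 | hδ1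
  · -- for `δ > 1` the event is empty
    have : uniformProb (fun x : Fin k → G => (supp (evalWord w x).1 : ℝ) ≤ (1 - δ) * n) = 0 := by
      have : IsEmpty {x : Fin k → G // (supp (evalWord w x).1 : ℝ) ≤ (1 - δ) * n} := by
        refine ⟨fun x => ?_⟩
        have h1 := x.2
        have h2 : (0 : ℝ) ≤ supp (evalWord w x.1).1 := Nat.cast_nonneg _
        nlinarith
      rw [uniformProb, Nat.card_eq_zero.2 (Or.inl this), Nat.cast_zero, zero_div]
    rw [this]
    positivity
  obtain ⟨c, hcyc, hc0, hcle, u, hwu⟩ := exists_isCyclicallyReduced hw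
  set y : ℝ := δ * n with hy
  have hy0 : 0 < y := mul_pos hδ hn
  set κ := ⌈y⌉₊ with hκ
  have hκ0 : 0 < κ := Nat.ceil_pos.2 hy0
  have hyκ : y ≤ κ := Nat.le_ceil y
  set z : ℝ := y ^ 2 / (160 * ℓ) with hz
  set N := Nat.card (Fin k → G) with hN
  have hN0 : (0 : ℝ) < N := by
    rw [hN]
    exact_mod_cast Nat.card_pos
  have hD : ((n / κ : ℕ) : ℝ) ≤ 1 / δ := by
    refine Nat.cast_div_le.trans ?_
    rw [div_le_div_iff₀ (by exact_mod_cast hκ0) hδ]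
    linarith
  have hevent : ∀ x : Fin k → G, (supp (evalWord w x).1 : ℝ) ≤ (1 - δ) * n →
      supp (evalWord (FreeGroup.mk c) x).1 + κ ≤ n := by
    intro x hx
    rw [hwu, supp_evalWord_conj] at hx
    have h1 : supp (evalWord (FreeGroup.mk c) x).1 ≤ n := by
      have : (supp (evalWord (FreeGroup.mk c) x).1 : ℝ) ≤ n := by nlinarith
      exact_mod_cast this
    have h2 : κ ≤ n - supp (evalWord (FreeGroup.mk c) x).1 := by
      rw [hκ, Nat.ceil_le, Nat.cast_sub h1]
      linarith
    omega
  have hterm : ∀ d ∈ Finset.Icc 1 (n / κ), (Nat.card {x : Fin k → G //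
      Nat.card F ^ (d * κ) ≤ Nat.card (cyclicVectors (evalWord (FreeGroup.mk c) x).1 d)} : ℝ) ≤
      N * q ^ (-z) := by
    intro d hd
    obtain ⟨hd0, hd1⟩ := Finset.mem_Icc.1 hd
    have hdκ : d * κ ≤ n := (Nat.le_div_iff_mul_le hκ0).1 hd1
    have hdδ : (d : ℝ) * δ ≤ 1 := by
      have h1 : (d : ℝ) ≤ 1 / δ := (Nat.cast_le.2 hd1).trans hD
      rwa [le_div_iff₀ hδ] at h1
    have hcℓ : (c.length : ℝ) ≤ ℓ := Nat.cast_le.2 hcle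
    have h20 : 20 * (d * c.length) < κ := by
      have h1 : (20 : ℝ) * (d * c.length) < κ := by
        have hd0' : (0 : ℝ) < d := by exact_mod_cast hd0
        calc (20 : ℝ) * (d * c.length) ≤ d * (20 * ℓ) := by nlinarith
          _ < d * (δ ^ 2 * n) := mul_lt_mul_of_pos_left (by linarith) hd0'
          _ = (d * δ) * y := by rw [hy]; ring
          _ ≤ 1 * y := mul_le_mul_of_nonneg_right hdδ hy0.le
          _ ≤ κ := by linarith
      exact_mod_cast h1
    obtain ⟨s, hs, hcard⟩ := exists_card_mul_pow_le hG hcyc hc0 hd0 h20 hdκ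
    have hzs : z ≤ s := by
      rw [hz, div_le_iff₀ (by positivity)]
      have h1 : (κ : ℝ) ^ 2 ≤ 160 * c.length * s := by exact_mod_cast hs
      have h2 : y ^ 2 ≤ (κ : ℝ) ^ 2 := pow_le_pow_left₀ hy0.le hyκ 2
      have h3 : (c.length : ℝ) * s ≤ ℓ * s := mul_le_mul_of_nonneg_right hcℓ (Nat.cast_nonneg s)
      nlinarith
    have hcard' : (Nat.card {x : Fin k → G // Nat.card F ^ (d * κ) ≤
        Nat.card (cyclicVectors (evalWord (FreeGroup.mk c) x).1 d)} : ℝ) * q ^ s ≤ N := by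
      rw [hq, hN]
      exact_mod_cast hcard
    rw [Real.rpow_neg hq0.le, ← div_eq_mul_inv, le_div_iff₀ (Real.rpow_pos_of_pos hq0 z)]
    refine le_trans (mul_le_mul_of_nonneg_left ?_ (Nat.cast_nonneg _)) hcard'
    rw [← Real.rpow_natCast]
    exact Real.rpow_le_rpow_of_exponent_le (by linarith) hzs
  have hcount : (Nat.card {x : Fin k → G // (supp (evalWord w x).1 : ℝ) ≤ (1 - δ) * n} : ℝ) ≤
      1 / δ * (N * q ^ (-z)) := by
    have h1 : Nat.card {x : Fin k → G // (supp (evalWord w x).1 : ℝ) ≤ (1 - δ) * n} ≤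
        Nat.card {x : Fin k → G // supp (evalWord (FreeGroup.mk c) x).1 + κ ≤ n} :=
      Nat.card_le_card_of_injective (Subtype.map id hevent)
        (Subtype.map_injective hevent Function.injective_id)
    have h2 := h1.trans (card_supp_le c hκ0)
    have h3 : (Nat.card {x : Fin k → G // (supp (evalWord w x).1 : ℝ) ≤ (1 - δ) * n} : ℝ) ≤
        ∑ d ∈ Finset.Icc 1 (n / κ), (Nat.card {x : Fin k → G // Nat.card F ^ (d * κ) ≤
          Nat.card (cyclicVectors (evalWord (FreeGroup.mk c) x).1 d)} : ℝ) := by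
      exact_mod_cast h2
    refine (h3.trans (Finset.sum_le_card_nsmul _ _ _ hterm)).trans ?_
    rw [nsmul_eq_mul, Nat.card_Icc, Nat.add_sub_cancel]
    exact mul_le_mul_of_nonneg_right hD (by positivity)
  -- half of the exponent absorbs the number of degrees
  have hδz : 1 / δ ≤ q ^ (z / 2) := by
    have hδ' : 1 ≤ 1 / δ := by rwa [le_div_iff₀ hδ, one_mul]
    have h1 : 1 / δ ≤ z / 2 := by
      rw [hz, div_le_iff₀ hδ, div_div, div_mul_eq_mul_div, le_div_iff₀ (by positivity)]
      have h2 : 20 * ℓ * n < y ^ 2 := by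
        have := mul_lt_mul_of_pos_right hℓ hn
        rw [hy]
        nlinarith
      have h3 : 20 * ℓ < δ * y := by rw [hy]; nlinarith
      have h4 : δ * y ≤ y := by nlinarith
      nlinarith
    have h5 := one_add_mul_self_le_rpow_one_add (s := q - 1) (by linarith) hδ'
    rw [add_sub_cancel] at h5
    calc 1 / δ ≤ 1 + 1 / δ * (q - 1) := by nlinarith
      _ ≤ q ^ (1 / δ) := h5
      _ ≤ q ^ (z / 2) := Real.rpow_le_rpow_of_exponent_le (by linarith) h1
  have hGle : (Nat.card G : ℝ) ≤ q ^ ((n : ℝ) ^ 2) := by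
    have h1 : (Nat.card G : ℝ) ≤ q ^ (n ^ 2) := by
      rw [hq]
      exact_mod_cast card_subgroup_le G
    rw [← Real.rpow_natCast] at h1
    exact_mod_cast h1
  calc uniformProb (fun x : Fin k → G => (supp (evalWord w x).1 : ℝ) ≤ (1 - δ) * n)
      ≤ 1 / δ * (N * q ^ (-z)) / N := div_le_div_of_nonneg_right hcount hN0.le
    _ = 1 / δ * q ^ (-z) := by field_simp
    _ ≤ q ^ (z / 2) * q ^ (-z) := mul_le_mul_of_nonneg_right hδz (by positivity)
    _ = (q ^ ((n : ℝ) ^ 2)) ^ (-(1 / 320 * δ ^ 2 / ℓ)) := by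
      rw [← Real.rpow_add hq0, ← Real.rpow_mul hq0.le]
      congr 1
      rw [hz, hy]
      field_simp
      ring
    _ ≤ (Nat.card G : ℝ) ^ (-(1 / 320 * δ ^ 2 / ℓ)) :=
      Real.rpow_le_rpow_of_nonpos (by exact_mod_cast Nat.card_pos) hGle
        (neg_nonpos.2 (by positivity))
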